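/- Let $\mathfrak g$ be a finite-dimensional simple complex Lie algebra, $T\ge 1$, $\sigma$ an automorphism of $\mathfrak g$ with $\sigma^T=1$, $\varepsilon=e^{2\pi i/T}$, and $\mathfrak g_{[j]}=\{x\in\mathfrak g\mid \sigma x=\varepsilon^j x\}$ for $j\in\mathbb Z/T\mathbb Z$. Let $\langle\cdot,\cdot\rangle$ be a symmetric invariant bilinear form on $\mathfrak g$ and $k\in\mathbb C$. Let $$\hat{\mathfrak g}[\sigma]=\coprod_{j\in\mathbb Z}\mathfrak g_{[j]}\otimes t^{j/T}\oplus\mathbb C c,\qquad [x(i),y(j)]=[x,y](i+j)+i\,\delta_{i+j,0}\langle x,y\rangle c,$$ where $c$ is central and $x(s/T)=x\otimes t^{s/T}$ for $x\in\mathfrak g_{[s]}$, and let $\mathcal U^\sigma=U(\hat{\mathfrak g}[\sigma])/(c-k)$, graded by $\deg x(i)=i$, with homogeneous components $\mathcal U^\sigma(n)$, $n\in\frac1T\mathbb Z$. Let $\overline{\mathcal U^\sigma(n)}$ be the completion of $\mathcal U^\sigma(n)$ for the group topology in which the subspaces $V_p(n)=\sum_{i\in\frac1T\mathbb Z,\ i\ge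 p}\mathcal U^\sigma(n-i)\,\mathcal U^\sigma(i)$, $p=1,2,\dots$, form a fundamental system of neighbourhoods of $0$. Let $B_{[j]}$ be a basis of $\mathfrak g_{[j]}$ for each $j\in\mathbb Z/T\mathbb Z$, and $\bar B=\bigcup_{j\in\mathbb Z}B_{[j]}\otimes t^{j/T}$ with a linear order $\preceq$ such that $i<j$ implies $x(i)\prec y(j)$. Let $\mathcal P$ be the monoid of colored partitions, i.e. of finite monomials $\pi=b_1(j_1)\cdots b_\ell(j_\ell)$ in elements of $\bar B$, with parts indexed so that $b_1(j_1)\preceq\dots\preceq b_\ell(j_\ell)$; put $\ell(\pi)=\ell$, $|\pi|=j_1+\dots+j_\ell$, and $u(\pi)=b_1(j_1)\cdots b_\ell(j_\ell)\in\mathcal U^\sigma(|\pi|)$. Let $\preceq$ be a linear order on $\mathcal P$ which extends the order on $\bar B$ and satisfies: 1. $\ell(\pi)>\ell(\kappa)$ implies $\pi\prec\kappa$; 2. $\ell(\pi)=\ell(\kappa)$ and $|\pi|<|\kappa|$ imply $\pi\prec\kappa$; 3. if $\ell(\pi)=\ell(\kappa)\geq 1$, $|\pi|=|\kappa|$ and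 $\pi\preceq\kappa$, then the degree of the last part of $\pi$ is at most the degree of the last part of $\kappa$; 4. for all $\ell\ge 0$ and $n\in\frac1T\mathbb Z$, every nonempty set of colored partitions of degree $n$ and length at most $\ell$ has a minimal element; 5. $\mu\preceq\nu$ implies $\pi\mu\preceq\pi\nu$. For $\pi\in\mathcal P$ with $|\pi|=n$, let $U^{\mathcal P}_{[\pi]}$ and $U^{\mathcal P}_{(\pi)}$ be the closures in $\overline{\mathcal U^\sigma(n)}$ of the $\mathbb C$-spans of $\{u(\pi')\mid|\pi'|=n,\ \pi'\succeq\pi\}$ and $\{u(\pi')\mid|\pi'|=n,\ \pi'\succ\pi\}$ respectively, and let $U^{\mathcal P}(n)=\bigcup_{|\pi|=n}U^{\mathcal P}_{[\pi]}$. A colored partition $\pi$ with $|\pi|=n$ is called a leading term of $u\in\overline{\mathcal U^\sigma(n)}$ if $u\in U^{\mathcal P}_{[\pi]}$ and $u\notin U^{\mathcal P}_{(\pi)}$. Then: (a) for every $\pi\in\mathcal P$, $U^{\mathcal P}_{[\pi]}=\mathbb C\,u(\pi)+U^{\mathcal P}_{(\pi)}$ and $\dim U^{\mathcal P}_{[\pi]}/U^{\mathcal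 P}_{(\pi)}=1$; (b) for every $n\in\frac1T\mathbb Z$, every nonzero $u\in U^{\mathcal P}(n)$ has a unique leading term. -/

import Mathlib

open scoped TensorProduct

noncomputable section

set_option linter.unusedSectionVars false

namespace TwistedAffine

universe u v

/-- The data behind the twisted affine algebra `ĝ[σ]` and its level-`k` enveloping algebra:
an automorphism `σ` of `𝔤` with `σ ^ T = 1`, a symmetric invariant bilinear form on `𝔤` (of any
normalisation), and a level `k`. -/
structure Datum (𝔤 : Type u) [LieRing 𝔤] [LieAlgebra ℂ 𝔤] (T : ℕ) where
  σ : 𝔤 ≃ₗ⁅ℂ⁆ 𝔤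
  σ_pow : ∀ x, σ^[T] x = x
  form : LinearMap.BilinForm ℂ 𝔤
  form_symm : form.IsSymm
  form_invariant : form.lieInvariant 𝔤
  k : ℂ

/-- The primitive root of unity `ε = exp (2πi / T)`. -/
def rootOfUnity (T : ℕ) : ℂ := Complex.exp (2 * Real.pi * Complex.I / T)

lemma rootOfUnity_pow (T : ℕ) [NeZero T] : rootOfUnity T ^ T = 1 :=
  (Complex.isPrimitiveRoot_exp T (NeZero.ne T)).pow_eq_one

section Algebra

variable {𝔤 : Type u} [LieRing 𝔤] [LieAlgebra ℂ 𝔤] {T : ℕ} [NeZero T] (D : Datum 𝔤 T)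

/-- The eigenspace `𝔤_[j] = {x | σ x = ε ^ j x}`, for `j ∈ ℤ / Tℤ`. -/
def Datum.component (j : ZMod T) : Submodule ℂ 𝔤 where
  carrier := {x | D.σ x = rootOfUnity T ^ j.val • x}
  add_mem' {x y} hx hy := by
    simp only [Set.mem_ofPred_eq] at *
    rw [map_add, hx, hy, smul_add]
  zero_mem' := by simp
  smul_mem' a x hx := by
    simp only [Set.mem_ofPred_eq] at *
    rw [map_smul, hx, smul_comm]

lemma Datum.lie_mem_component {i j : ZMod T} {x y : 𝔤}
    (hx : x ∈ D.component i) (hy : y ∈ D.component j) : ⁅x, y⁆ ∈ D.component (i + j) := by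
  change D.σ x = _ at hx
  change D.σ y = _ at hy
  change D.σ ⁅x, y⁆ = _
  rw [LieEquiv.map_lie, hx, hy, smul_lie, lie_smul, smul_smul, ← pow_add, ZMod.val_add,
    ← pow_eq_pow_mod _ (rootOfUnity_pow T)]

/-- The cocycle `(x ⊗ t^{i/T}, y ⊗ t^{j/T}) ↦ (i/T) δ_{i+j,0} ⟨x, y⟩` on `𝔤 ⊗ ℂ[t^{±1/T}]`; the
variable of the loop algebra stands for `t^{1/T}`. Mathlib's cocycle of a form `Φ` is
`j δ_{i+j,0} Φ x y`, whence the factor `-1/T`. -/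
abbrev Datum.cocycle :=
  LieAlgebra.LoopAlgebra.twoCocycleOfBilinear ℂ ℤ 𝔤 ((-(T : ℂ)⁻¹) • D.form)
    (fun x y z => by simp [D.form_invariant x y z])
    ⟨fun x y => by simp [D.form_symm.eq x y]⟩

/-- The central extension `𝔤 ⊗ ℂ[t^{±1/T}] ⊕ ℂ c`. -/
abbrev Datum.Cover := LieAlgebra.ofTwoCocycle D.cocycle

/-- The element `x(j/T) = x ⊗ t^{j/T}` of the central extension. -/
def Datum.loop (j : ℤ) (x : 𝔤) : D.Cover :=
  LieAlgebra.ofProd D.cocycle (AddMonoidAlgebra.single j 1 ⊗ₜ[ℂ] x, 0)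

/-- The canonical central element `c`. -/
def Datum.c : D.Cover :=
  LieAlgebra.ofProd D.cocycle (0, (TrivialLieModule.equiv ℂ _ ℂ).symm 1)

/-- The commutator `[x(i/T), y(j/T)] = [x, y]((i+j)/T) + (i/T) δ_{i+j,0} ⟨x, y⟩ c`. -/
lemma Datum.lie_loop (i j : ℤ) (x y : 𝔤) :
    ⁅D.loop i x, D.loop j y⁆ =
      D.loop (i + j) ⁅x, y⁆ + (if i + j = 0 then ((i : ℂ) / T) * D.form x y else 0) • D.c := by
  rw [LieAlgebra.bracket_ofTwoCocycle, loop, loop, loop, c, ← LieAlgebra.of_smul, ← LieAlgebra.of_add]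
  simp only [Equiv.symm_apply_apply]
  refine congrArg _ (Prod.ext ?_ ?_)
  · rw [Prod.fst_add, Prod.smul_fst, smul_zero, add_zero, LieAlgebra.ExtendScalars.bracket_tmul,
      AddMonoidAlgebra.single_mul_single, mul_one]
  · have key : LieAlgebra.LoopAlgebra.residuePairing ℂ ℤ 𝔤 ((-(T : ℂ)⁻¹) • D.form)
        (AddMonoidAlgebra.single i 1 ⊗ₜ[ℂ] x) (AddMonoidAlgebra.single j 1 ⊗ₜ[ℂ] y) =
        if i + j = 0 then ((i : ℂ) / T) * D.form x y else 0 := by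
      rw [LieAlgebra.LoopAlgebra.residuePairing_apply_apply]
      simp only [LieAlgebra.LoopAlgebra.toFinsupp_single_tmul]
      rw [Finsupp.sum_single_index (by simp)]
      split_ifs with h
      · obtain rfl : j = -i := by omega
        simp
        ring
      · rw [Finsupp.single_eq_of_ne (by omega)]
        simp
    rw [lie_zero, lie_zero, add_zero, sub_zero, Prod.snd_add, Prod.smul_snd, zero_add, ← key]
    exact (mul_one (M := ℂ) _).symm

lemma Datum.lie_c (z : D.Cover) : ⁅z, D.c⁆ = 0 := by
  rw [LieAlgebra.bracket_ofTwoCocycle, c, ← LieAlgebra.of_zero]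
  refine congrArg _ (Prod.ext ?_ ?_)
  · simp
  · simp [LieModule.IsTrivial.trivial]

lemma Datum.c_lie (z : D.Cover) : ⁅D.c, z⁆ = 0 := by
  rw [← lie_skew, D.lie_c, neg_zero]

/-- The set of spanning elements of `ĝ[σ]`: `c` and the `x(j/T)` with `x ∈ 𝔤_[j]`. -/
def Datum.generators : Set D.Cover :=
  {z | ∃ (j : ℤ) (x : 𝔤), x ∈ D.component (j : ZMod T) ∧ z = D.loop j x} ∪ {D.c}

/-- The Lie algebra `ĝ[σ] = ∐_j 𝔤_[j] ⊗ t^{j/T} + ℂ c`. -/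
def Datum.hat : LieSubalgebra ℂ D.Cover where
  toSubmodule := Submodule.span ℂ D.generators
  lie_mem' {z w} hz hw := by
    change z ∈ Submodule.span ℂ D.generators at hz
    change w ∈ Submodule.span ℂ D.generators at hw
    change ⁅z, w⁆ ∈ Submodule.span ℂ D.generators
    induction hz using Submodule.span_induction with
    | zero => simp
    | add a b _ _ ha hb => rw [add_lie]; exact add_mem ha hb
    | smul r a _ ha => rw [smul_lie]; exact Submodule.smul_mem _ _ ha
    | mem z hz =>
      induction hw using Submodule.span_induction with
      | zero => simp
      | add a b _ _ ha hb => rw [lie_add]; exact add_mem ha hb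
      | smul r a _ ha => rw [lie_smul]; exact Submodule.smul_mem _ _ ha
      | mem w hw =>
        rcases hz with ⟨i, x, hx, rfl⟩ | rfl
        · rcases hw with ⟨j, y, hy, rfl⟩ | rfl
          · rw [D.lie_loop]
            refine add_mem (Submodule.subset_span (Or.inl ⟨i + j, ⁅x, y⁆, ?_, rfl⟩))
              (Submodule.smul_mem _ _ (Submodule.subset_span (Or.inr rfl)))
            rw [Int.cast_add]
            exact D.lie_mem_component hx hy
          · rw [D.lie_c]; exact zero_mem _
        · rw [D.c_lie]; exact zero_mem _

/-- `x(j/T)` as an element of `ĝ[σ]`, for `x ∈ 𝔤_[j]`. -/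
def Datum.hatLoop (j : ℤ) (x : D.component (j : ZMod T)) : D.hat :=
  ⟨D.loop j x, Submodule.subset_span (Or.inl ⟨j, x, x.2, rfl⟩)⟩

/-- `c` as an element of `ĝ[σ]`. -/
def Datum.hatC : D.hat := ⟨D.c, Submodule.subset_span (Or.inr rfl)⟩

/-- The relation `c = k` in the universal enveloping algebra of `ĝ[σ]`. -/
inductive Datum.LevelRel : UniversalEnvelopingAlgebra ℂ D.hat →
    UniversalEnvelopingAlgebra ℂ D.hat → Prop
  | level : Datum.LevelRel (UniversalEnvelopingAlgebra.ι ℂ D.hatC) (algebraMap ℂ _ D.k)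

/-- The algebra `𝒰^σ = U(ĝ[σ]) / (c - k)`. -/
def Datum.Env : Type u := RingQuot D.LevelRel

instance : Ring D.Env := inferInstanceAs (Ring (RingQuot D.LevelRel))
instance : Algebra ℂ D.Env := inferInstanceAs (Algebra ℂ (RingQuot D.LevelRel))

/-- The image of `x(j/T)` in `𝒰^σ`. -/
def Datum.gen (j : ℤ) (x : D.component (j : ZMod T)) : D.Env :=
  RingQuot.mkAlgHom ℂ D.LevelRel (UniversalEnvelopingAlgebra.ι ℂ (D.hatLoop j x))

/-- The homogeneous component `𝒰^σ(n/T)` of degree `n/T`, spanned by the products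
`x₁(j₁/T) ⋯ xₗ(jₗ/T)` with `j₁ + ⋯ + jₗ = n`. Degrees in `(1/T)ℤ` are represented throughout by
their integer numerators. -/
def Datum.homog (n : ℤ) : Submodule ℂ D.Env :=
  Submodule.span ℂ {a | ∃ l : List (Σ j : ℤ, D.component (j : ZMod T)),
    (l.map Sigma.fst).sum = n ∧ a = (l.map fun b => D.gen b.1 b.2).prod}

/-- `V_p(n/T) = ∑_{i/T ≥ p} 𝒰^σ((n-i)/T) 𝒰^σ(i/T)`, as a subspace of `𝒰^σ`. -/
def Datum.nbhd (p : ℕ) (n : ℤ) : Submodule ℂ D.Env :=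
  ⨆ (i : ℤ) (_ : (p : ℤ) * T ≤ i), D.homog (n - i) * D.homog i

lemma Datum.nbhd_anti {p q : ℕ} (h : p ≤ q) (n : ℤ) : D.nbhd q n ≤ D.nbhd p n := by
  refine iSup_mono fun i => iSup_mono' fun hi => ⟨le_trans ?_ hi, le_rfl⟩
  gcongr

/-- The homogeneous component `𝒰^σ(n/T)` as a type, which carries the topology given by the
`V_p(n/T)`, `p = 1, 2, …`. -/
def Datum.Homog (n : ℤ) : Type u := D.homog n

instance (n : ℤ) : AddCommGroup (D.Homog n) := inferInstanceAs (AddCommGroup (D.homog n))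
instance (n : ℤ) : Module ℂ (D.Homog n) := inferInstanceAs (Module ℂ (D.homog n))

/-- `V_p(n/T)` as a subspace of `𝒰^σ(n/T)`. -/
def Datum.nbhdIn (p : ℕ) (n : ℤ) : Submodule ℂ (D.Homog n) :=
  (D.nbhd p n).comap (D.homog n).subtype

lemma Datum.nbhdIn_anti {p q : ℕ} (h : p ≤ q) (n : ℤ) : D.nbhdIn q n ≤ D.nbhdIn p n :=
  Submodule.comap_mono (D.nbhd_anti h n)

/-- The `V_p(n/T)`, `p = 1, 2, …`, as a fundamental system of neighbourhoods of `0`. -/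
@[reducible] def Datum.filterBasis (n : ℤ) : AddGroupFilterBasis (D.Homog n) :=
  addGroupFilterBasisOfComm {S | ∃ p : ℕ, 1 ≤ p ∧ S = (D.nbhdIn p n : Set (D.Homog n))}
    ⟨_, 1, le_rfl, rfl⟩
    (by
      rintro _ _ ⟨p, hp, rfl⟩ ⟨q, hq, rfl⟩
      exact ⟨_, ⟨max p q, le_max_of_le_left hp, rfl⟩, Set.subset_inter
        (D.nbhdIn_anti (le_max_left p q) n) (D.nbhdIn_anti (le_max_right p q) n)⟩)
    (by rintro _ ⟨p, hp, rfl⟩; exact zero_mem _)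
    (by
      rintro _ ⟨p, hp, rfl⟩
      refine ⟨_, ⟨p, hp, rfl⟩, ?_⟩
      rintro _ ⟨a, ha, b, hb, rfl⟩
      exact add_mem ha hb)
    (by
      rintro _ ⟨p, hp, rfl⟩
      exact ⟨_, ⟨p, hp, rfl⟩, fun a ha => neg_mem ha⟩)

instance (n : ℤ) : TopologicalSpace (D.Homog n) := (D.filterBasis n).topology
instance (n : ℤ) : IsTopologicalAddGroup (D.Homog n) := (D.filterBasis n).isTopologicalAddGroup
instance (n : ℤ) : UniformSpace (D.Homog n) :=
  IsTopologicalAddGroup.rightUniformSpace (D.Homog n)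
instance (n : ℤ) : IsUniformAddGroup (D.Homog n) := isUniformAddGroup_of_addCommGroup

instance (n : ℤ) : UniformContinuousConstSMul ℂ (D.Homog n) where
  uniformContinuous_const_smul r := by
    refine uniformContinuous_of_continuousAt_zero (DistribSMul.toAddMonoidHom (D.Homog n) r) ?_
    rw [ContinuousAt, map_zero,
      ((D.filterBasis n).nhds_zero_hasBasis).tendsto_iff (D.filterBasis n).nhds_zero_hasBasis]
    rintro _ ⟨p, hp, rfl⟩
    exact ⟨_, ⟨p, hp, rfl⟩, fun a ha => Submodule.smul_mem _ r ha⟩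

/-- The completion of `𝒰^σ(n/T)`. -/
abbrev Datum.Completed (n : ℤ) : Type u := UniformSpace.Completion (D.Homog n)

end Algebra

section Partitions

variable {T : ℕ} (ι : ZMod T → Type v)

/-- Index of an element `b(j/T)` of the basis `B̄ = ⋃_j B_[j] ⊗ t^{j/T}`, where `ι j` indexes
`B_[j]`. -/
structure Part where
  degree : ℤ
  color : ι (degree : ZMod T)

/-- A colored partition: a monomial in the elements of `B̄`. -/
@[ext]
structure ColoredPartition where
  parts : Multiset (Part ι)

variable {ι}

/-- The length `ℓ(π)`. -/
def ColoredPartition.length (π : ColoredPartition ι) : ℕ := Multiset.card π.parts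

/-- The numerator of the degree `|π| ∈ (1/T)ℤ`. -/
def ColoredPartition.degree (π : ColoredPartition ι) : ℤ := (π.parts.map Part.degree).sum

/-- The product of monomials. -/
instance : Mul (ColoredPartition ι) := ⟨fun π κ => ⟨π.parts + κ.parts⟩⟩

/-- A part viewed as a colored partition of length one. -/
def Part.toPartition (b : Part ι) : ColoredPartition ι := ⟨{b}⟩

/-- `b` is the last part of `π` when its parts are listed in increasing order. -/
def ColoredPartition.IsLastPart [LinearOrder (Part ι)] (π : ColoredPartition ι) (b : Part ι) :
    Prop :=
  IsGreatest {a | a ∈ π.parts} b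

variable (ι) in
/-- The assumed properties of the linear orders on `B̄` and on the set of colored partitions. -/
structure IsAdmissible [LinearOrder (Part ι)] [LinearOrder (ColoredPartition ι)] : Prop where
  part_lt : ∀ a b : Part ι, a.degree < b.degree → a < b
  extends_parts : ∀ a b : Part ι, a.toPartition ≤ b.toPartition ↔ a ≤ b
  lt_of_length : ∀ π κ : ColoredPartition ι, κ.length < π.length → π < κ
  lt_of_degree : ∀ π κ : ColoredPartition ι,
    π.length = κ.length → π.degree < κ.degree → π < κ
  last_part_le : ∀ π κ : ColoredPartition ι, π.length = κ.length → π.degree = κ.degree →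
    π ≤ κ → ∀ b a : Part ι, π.IsLastPart b → κ.IsLastPart a → b.degree ≤ a.degree
  exists_min : ∀ (l : ℕ) (n : ℤ) (S : Set (ColoredPartition ι)), S.Nonempty →
    (∀ π ∈ S, π.length ≤ l ∧ π.degree = n) → ∃ π ∈ S, ∀ κ ∈ S, π ≤ κ
  mul_le_mul : ∀ π μ ν : ColoredPartition ι, μ ≤ ν → π * μ ≤ π * ν

variable (ι) in
/-- The colored partitions of degree `n/T`. -/
abbrev PartitionsOf (n : ℤ) : Type v := {π : ColoredPartition ι // π.degree = n}

end Partitions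

section Filtration

variable {𝔤 : Type u} [LieRing 𝔤] [LieAlgebra ℂ 𝔤] {T : ℕ} [NeZero T] {D : Datum 𝔤 T}
  {ι : ZMod T → Type v} (B : ∀ j, Module.Basis (ι j) ℂ (D.component j)) [LinearOrder (Part ι)]

/-- The monomial `u(π) = b₁(j₁) ⋯ bₗ(jₗ)`, with the parts of `π` in increasing order. -/
def monomial (π : ColoredPartition ι) : D.Env :=
  ((π.parts.sort (· ≤ ·)).map fun b => D.gen b.degree (B _ b.color)).prod

lemma monomial_mem {n : ℤ} (π : PartitionsOf ι n) : monomial B π.1 ∈ D.homog n := by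
  obtain ⟨π, rfl⟩ := π
  refine Submodule.subset_span
    ⟨(π.parts.sort (· ≤ ·)).map fun b => ⟨b.degree, B _ b.color⟩, ?_, ?_⟩
  · rw [List.map_map, ColoredPartition.degree, ← Multiset.sort_eq π.parts (· ≤ ·),
      Multiset.map_coe, Multiset.sum_coe]
    simp [Function.comp_def]
  · simp [monomial, Function.comp_def]

/-- `u(π)` as an element of `𝒰^σ(n/T)`, for `|π| = n/T`. -/
def homogMonomial {n : ℤ} (π : PartitionsOf ι n) : D.Homog n :=
  (⟨monomial B π.1, monomial_mem B π⟩ : D.homog n)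

/-- `u(π)` as an element of the completion of `𝒰^σ(n/T)`, for `|π| = n/T`. -/
def completedMonomial {n : ℤ} (π : PartitionsOf ι n) : D.Completed n :=
  (homogMonomial B π : UniformSpace.Completion (D.Homog n))

variable [LinearOrder (ColoredPartition ι)]

/-- `U_[π]`: the closure of the span of the `u(π')` with `|π'| = |π|` and `π' ⪰ π`. -/
def closedGE {n : ℤ} (π : PartitionsOf ι n) : Submodule ℂ (D.Completed n) :=
  (Submodule.span ℂ {x | ∃ π' : PartitionsOf ι n, π ≤ π' ∧
    x = completedMonomial B π'}).topologicalClosure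

/-- `U_(π)`: the closure of the span of the `u(π')` with `|π'| = |π|` and `π' ≻ π`. -/
def closedGT {n : ℤ} (π : PartitionsOf ι n) : Submodule ℂ (D.Completed n) :=
  (Submodule.span ℂ {x | ∃ π' : PartitionsOf ι n, π < π' ∧
    x = completedMonomial B π'}).topologicalClosure

/-- `U^𝒫(n/T) = ⋃_{|π| = n/T} U_[π]`. -/
def homogUP (n : ℤ) : Set (D.Completed n) :=
  ⋃ π : PartitionsOf ι n, (closedGE B π : Set (D.Completed n))

/-- `π` is a leading term of `x`. -/
def IsLeadingTerm {n : ℤ} (x : D.Completed n) (π : PartitionsOf ι n) : Prop :=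
  x ∈ closedGE B π ∧ x ∉ closedGT B π

end Filtration

end TwistedAffine

end

noncomputable section

set_option linter.unusedSectionVars false

namespace OrderedPBW

attribute [local instance] LieRing.ofAssociativeRing

/-! ### Splitting a multiset at its least element. -/

section LeastElement

variable {I : Type*} [LinearOrder I]

/-! Everything is read off from coordinates on the completion. By Poincaré–Birkhoff–Witt the ordered
monomials u(π) with |π| = n form a basis of 𝒰^σ(n) (`homogBasis`). In this basis V_p(n) is the span
of the monomials whose parts of positive degree have total degree at least p: straightening a
product of positive parts creates only positive parts and preserves the total degree
(`nbhd_le_monomialsPos`, `monomial_mem_nbhd`). Hence each coefficient functional vanishes on some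
V_p(n) and extends continuously to the completion (`completedCoord`).

The key is `mem_closedSpan_iff`: the closed span of a family of monomials consists of the elements
whose coefficients at all other monomials vanish. For the empty family this says that the
coefficients determine the element. So U_(π) is the kernel in U_[π] of the coefficient at π, which
gives (a). A leading term of u is the least π with nonzero coefficient, hence unique. It exists
because u ∈ U_[π₀] confines the support to lengths at most ℓ(π₀), longer partitions being smaller,
and there condition 4 supplies a minimum.

Linear independence of the monomials comes from a representation on polynomials in which u(π) sends
1 to π (`OrderedPBW.repHom`, `linearIndependent_monomial`). Spanning comes from sorting words at the
cost of shorter ones (`word_sub_word_mem`). -/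

lemma exists_least_cons {M : Multiset I} (hM : M ≠ 0) :
    ∃ p : I × Multiset I, M = p.1 ::ₘ p.2 ∧ ∀ ν ∈ p.2, p.1 ≤ ν := by
  obtain ⟨μ, hμ, hle⟩ := M.toFinset.exists_minimal (by simpa using hM)
  rw [Multiset.mem_toFinset] at hμ
  refine ⟨(μ, M.erase μ), (Multiset.cons_erase hμ).symm, fun ν hν => ?_⟩
  rcases le_total μ ν with h | h
  · exact h
  · exact hle (Multiset.mem_toFinset.2 (Multiset.mem_of_mem_erase hν)) h

/-- The least element of a nonempty multiset, together with the remaining elements. -/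
def leastCons (M : Multiset I) (hM : M ≠ 0) : I × Multiset I :=
  (exists_least_cons hM).choose

lemma leastCons_eq {M : Multiset I} (hM : M ≠ 0) :
    M = (leastCons M hM).1 ::ₘ (leastCons M hM).2 :=
  (exists_least_cons hM).choose_spec.1

lemma leastCons_le {M : Multiset I} (hM : M ≠ 0) :
    ∀ ν ∈ (leastCons M hM).2, (leastCons M hM).1 ≤ ν :=
  (exists_least_cons hM).choose_spec.2

/-- Antisymmetry makes the splitting unique, so the recursion in `act` can be evaluated on any
presentation `μ ::ₘ N` with `μ` least. -/
lemma leastCons_cons {μ : I} {N : Multiset I} (h : ∀ ν ∈ N, μ ≤ ν) :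
    leastCons (μ ::ₘ N) (Multiset.cons_ne_zero) = (μ, N) := by
  have h₁ := leastCons_eq (Multiset.cons_ne_zero (a := μ) (m := N))
  have h₂ := leastCons_le (Multiset.cons_ne_zero (a := μ) (m := N))
  generalize leastCons (μ ::ₘ N) Multiset.cons_ne_zero = p at h₁ h₂
  obtain ⟨μ', N'⟩ := p
  simp only at h₁ h₂
  have hle : μ ≤ μ' := by
    have : μ' ∈ μ ::ₘ N := h₁ ▸ Multiset.mem_cons_self μ' N'
    rcases Multiset.mem_cons.1 this with h' | h'
    · exact h'.ge
    · exact h _ h'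
  have hge : μ' ≤ μ := by
    have : μ ∈ μ' ::ₘ N' := h₁ ▸ Multiset.mem_cons_self μ N
    rcases Multiset.mem_cons.1 this with h' | h'
    · exact h'.ge
    · exact h₂ _ h'
  obtain rfl := le_antisymm hle hge
  rw [(Multiset.cons_inj_right μ).1 h₁]

lemma card_leastCons {M : Multiset I} (hM : M ≠ 0) :
    Multiset.card (leastCons M hM).2 < Multiset.card M := by
  conv_rhs => rw [leastCons_eq hM]
  simp

end LeastElement

/-! ### The ordered Poincaré–Birkhoff–Witt representation. -/

variable {R : Type*} [CommRing R] {L : Type*} [LieRing L] [LieAlgebra R L]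
  {I : Type*} [LinearOrder I] (b : Module.Basis (Option I) R L) (k : R)

open Classical in
/-- The action of the basis vector `b (some l)` on the monomial `M` in the ordered
Poincaré–Birkhoff–Witt representation, in which the central vector `b none` acts by `k`. -/
def act (M : Multiset I) (l : I) : Multiset I →₀ R :=
  if h : ∀ ν ∈ M, l ≤ ν then Finsupp.single (l ::ₘ M) 1
  else
    have hM : M ≠ 0 := fun h0 => h (by simp [h0])
    -- With M = μN and μ least, this encodes l·(μN) = μ·(l·N) + [l, μ]·N. The top term lN of l·N is
    -- split off, since μ acts on it by mere insertion; what is left has lower degree.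
    Finsupp.single (l ::ₘ M) 1 +
    ((act (leastCons M hM).2 l - Finsupp.single (l ::ₘ (leastCons M hM).2) 1).sum fun N a =>
      -- The test is there for termination; `corrBound` shows that it never fails on the support.
      if _hN : Multiset.card N < Multiset.card M then a • act N (leastCons M hM).1 else 0) +
    ((b.repr ⁅b (some l), b (some (leastCons M hM).1)⁆).sum fun o a =>
      match o with
      | none => a • k • Finsupp.single (leastCons M hM).2 1
      | some ν => a • act (leastCons M hM).2 ν)
termination_by Multiset.card M
decreasing_by
  · exact card_leastCons hM
  · exact _hN
  · exact card_leastCons hM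

/-- The linear operator on polynomials by which `b (some l)` acts. -/
def op (l : I) : Module.End R (Multiset I →₀ R) :=
  Finsupp.linearCombination R fun M => act b k M l

/-- The linear map `L → End` by which the Lie algebra acts. -/
def rep : L →ₗ[R] Module.End R (Multiset I →₀ R) :=
  b.constr R fun o => o.elim (k • LinearMap.id) (op b k)

lemma rep_none : rep b k (b none) = k • LinearMap.id := by simp [rep]

lemma rep_some (l : I) : rep b k (b (some l)) = op b k l := by simp [rep]

lemma op_single (l : I) (M : Multiset I) : op b k l (Finsupp.single M 1) = act b k M l := by
  simp [op]

lemma op_single_of_le {l : I} {M : Multiset I} (h : ∀ ν ∈ M, l ≤ ν) :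
    op b k l (Finsupp.single M 1) = Finsupp.single (l ::ₘ M) 1 := by
  rw [op_single, act, dif_pos h]

variable (R I) in
/-- The polynomials of degree at most `p`. -/
def filt (p : ℕ) : Submodule R (Multiset I →₀ R) :=
  Finsupp.supported R R {M | Multiset.card M ≤ p}

lemma filt_mono {p q : ℕ} (h : p ≤ q) : filt R I p ≤ filt R I q :=
  Finsupp.supported_mono fun _ hM => le_trans hM h

lemma single_mem_filt {p : ℕ} {M : Multiset I} (h : Multiset.card M ≤ p) (a : R) :
    Finsupp.single M a ∈ filt R I p :=
  Finsupp.single_mem_supported R a h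

/-- Linear statements on polynomials of degree at most `p` may be checked on monomials. -/
lemma filt_induction {p : ℕ} {S : Submodule R (Multiset I →₀ R)}
    (h : ∀ M : Multiset I, Multiset.card M ≤ p → Finsupp.single M 1 ∈ S) : filt R I p ≤ S := by
  rw [filt, Finsupp.supported_eq_span_single, Submodule.span_le]
  rintro _ ⟨M, hM, rfl⟩
  exact h M hM

lemma rep_apply_eq (x : L) (v : Multiset I →₀ R) :
    rep b k x v = (b.repr x).sum fun o a =>
      match o with
      | none => a • k • v
      | some ν => a • op b k ν v := by
  rw [rep, Module.Basis.constr_apply, Finsupp.sum, LinearMap.sum_apply, Finsupp.sum]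
  refine Finset.sum_congr rfl fun o _ => ?_
  cases o <;> simp

/-- A bound on the degrees of the correction terms on monomials of length at most `p`. -/
def CorrBound (p : ℕ) : Prop :=
  ∀ (M : Multiset I) (l : I), Multiset.card M ≤ p →
    op b k l (Finsupp.single M 1) - Finsupp.single (l ::ₘ M) 1 ∈ filt R I (Multiset.card M)

lemma CorrBound.op_mem {b : Module.Basis (Option I) R L} {k : R} {p q : ℕ}
    (h : CorrBound b k p) (hq : q ≤ p) (l : I)
    {v : Multiset I →₀ R} (hv : v ∈ filt R I q) : op b k l v ∈ filt R I (q + 1) := by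
  suffices filt R I q ≤ (filt R I (q + 1)).comap (op b k l) from this hv
  refine filt_induction fun M hM => ?_
  rw [Submodule.mem_comap]
  have h₁ := h M l (hM.trans hq)
  have h₂ : Finsupp.single (l ::ₘ M) (1 : R) ∈ filt R I (q + 1) :=
    single_mem_filt (by simpa using hM) 1
  have := add_mem (filt_mono (R := R) (I := I) (hM.trans (Nat.le_succ q)) h₁) h₂
  simpa using this

lemma CorrBound.rep_mem {b : Module.Basis (Option I) R L} {k : R} {p q : ℕ}
    (h : CorrBound b k p) (hq : q ≤ p) (x : L)
    {v : Multiset I →₀ R} (hv : v ∈ filt R I q) : rep b k x v ∈ filt R I (q + 1) := by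
  rw [rep_apply_eq]
  refine Submodule.sum_mem _ fun o _ => ?_
  cases o with
  | none => exact Submodule.smul_mem _ _ (Submodule.smul_mem _ _ (filt_mono (Nat.le_succ q) hv))
  | some ν => exact Submodule.smul_mem _ _ (h.op_mem hq ν hv)

/-- The defining recursion of the action, with the degree cut-off removed. -/
lemma op_single_cons_of_corrBound {p : ℕ} (hp : CorrBound b k p) {l μ : I} {N : Multiset I}
    (hN : Multiset.card N ≤ p)
    (hμ : ∀ ν ∈ N, μ ≤ ν) (hl : μ < l) :
    op b k l (Finsupp.single (μ ::ₘ N) 1) = Finsupp.single (l ::ₘ μ ::ₘ N) 1 +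
      op b k μ (op b k l (Finsupp.single N 1) - Finsupp.single (l ::ₘ N) 1) +
      rep b k ⁅b (some l), b (some μ)⁆ (Finsupp.single N 1) := by
  have hneg : ¬ ∀ ν ∈ μ ::ₘ N, l ≤ ν := fun h => (h μ (by simp)).not_gt hl
  rw [op_single, act, dif_neg hneg]
  simp only [leastCons_cons hμ]
  congr 1
  · congr 1
    have h := hp N l hN
    rw [op_single] at h ⊢
    conv_rhs => rw [op, Finsupp.linearCombination_apply]
    refine Finsupp.sum_congr fun Q hQ => ?_
    -- The bound `hp` puts the support of the correction in lengths at most that of `N`, so the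
    -- cut-off is vacuous.
    rw [dif_pos]
    have hcard : Multiset.card Q ≤ Multiset.card N := (Finsupp.mem_supported R _).1 h hQ
    simpa using Nat.lt_succ_of_le hcard
  · rw [rep_apply_eq]
    refine Finsupp.sum_congr fun o _ => ?_
    cases o with
    | none => rfl
    | some ν => simp only [op_single]

/-- Removing the cut-off at length p + 1 needs the bound only at length p, so induction closes. The
correction to l·(μN) is then μ applied to a polynomial of degree at most |N|, plus a bracket applied
to N, and each operator raises degree by at most one. -/
lemma corrBound (p : ℕ) : CorrBound b k p := by
  induction p with
  | zero =>
    intro M l hM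
    obtain rfl : M = 0 := by simpa using hM
    rw [op_single_of_le b k (by simp), sub_self]
    exact zero_mem _
  | succ p ih =>
    intro M l hM
    by_cases h : ∀ ν ∈ M, l ≤ ν
    · rw [op_single_of_le b k h, sub_self]
      exact zero_mem _
    have hM0 : M ≠ 0 := fun h0 => h (by simp [h0])
    obtain ⟨⟨μ, N⟩, rfl, hμ⟩ := exists_least_cons hM0
    simp only at hμ hM h ⊢
    have hl : μ < l := by
      by_contra hcon
      refine h fun ν hν => ?_
      rcases Multiset.mem_cons.1 hν with rfl | hν
      · exact not_lt.1 hcon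
      · exact (not_lt.1 hcon).trans (hμ ν hν)
    have hN : Multiset.card N ≤ p := by simpa using hM
    rw [op_single_cons_of_corrBound b k ih hN hμ hl, Multiset.card_cons]
    have e : ∀ a c d : Multiset I →₀ R, a + c + d - a = c + d := fun a c d => by abel
    rw [e]
    exact add_mem (ih.op_mem hN _ (ih N l hN)) (ih.rep_mem hN _ (single_mem_filt le_rfl 1))

/-- Since μ is below l and all of N, it acts on both N and lN by insertion, and the recursion
becomes the commutation relation. -/
lemma op_comm_of_lt {l μ : I} {N : Multiset I} (hμ : ∀ ν ∈ N, μ ≤ ν) (hl : μ < l) :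
    op b k l (op b k μ (Finsupp.single N 1)) = op b k μ (op b k l (Finsupp.single N 1)) +
      rep b k ⁅b (some l), b (some μ)⁆ (Finsupp.single N 1) := by
  have hμ' : ∀ ν ∈ l ::ₘ N, μ ≤ ν := fun ν hν => by
    rcases Multiset.mem_cons.1 hν with rfl | hν
    · exact hl.le
    · exact hμ ν hν
  rw [op_single_of_le b k hμ, op_single_cons_of_corrBound b k (corrBound b k _) le_rfl hμ hl, map_sub,
    op_single_of_le b k hμ', Multiset.cons_swap]
  abel

/-- `rep` respects the bracket of `x` and `y` on the vector `v`. -/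
def RespectsLie (x y : L) (v : Multiset I →₀ R) : Prop :=
  rep b k x (rep b k y v) - rep b k y (rep b k x v) = rep b k ⁅x, y⁆ v

variable {b k}

lemma RespectsLie.symm {x y : L} {v : Multiset I →₀ R} (h : RespectsLie b k x y v) :
    RespectsLie b k y x v := by
  rw [RespectsLie] at *
  rw [← lie_skew, map_neg, LinearMap.neg_apply, ← h, neg_sub]

lemma RespectsLie.add {x y : L} {v w : Multiset I →₀ R} (hv : RespectsLie b k x y v)
    (hw : RespectsLie b k x y w) : RespectsLie b k x y (v + w) := by
  rw [RespectsLie] at *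
  simp only [map_add, ← hv, ← hw]
  abel

lemma respectsLie_of_filt {x y : L} {p : ℕ}
    (h : ∀ M : Multiset I, Multiset.card M ≤ p → RespectsLie b k x y (Finsupp.single M 1))
    {v : Multiset I →₀ R} (hv : v ∈ filt R I p) : RespectsLie b k x y v := by
  have := filt_induction (S := LinearMap.ker
    (rep b k x * rep b k y - rep b k y * rep b k x - rep b k ⁅x, y⁆)) (p := p)
    (fun M hM => by simpa [sub_eq_zero, RespectsLie] using h M hM) hv
  simpa [sub_eq_zero, RespectsLie] using this

/-- By bilinearity basis vectors suffice; pairs involving the central one are trivial because it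
acts by a scalar. -/
lemma respectsLie_of_basis (hc : ∀ x : L, ⁅b none, x⁆ = 0) {v : Multiset I →₀ R}
    (h : ∀ l μ : I, RespectsLie b k (b (some l)) (b (some μ)) v) (x y : L) :
    RespectsLie b k x y v := by
  have key : ∀ o o' : Option I, RespectsLie b k (b o) (b o') v := by
    have h0 : ∀ o : Option I, RespectsLie b k (b none) (b o) v := fun o => by
      simp [RespectsLie, hc, rep_none]
    rintro (_ | l) (_ | μ)
    · exact h0 _
    · exact h0 _
    · exact (h0 _).symm
    · exact h l μ
  have key' : ∀ o, RespectsLie b k (b o) y v := fun o => by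
    induction b.mem_span y using Submodule.span_induction with
    | mem y hy =>
      obtain ⟨i, rfl⟩ := hy
      exact key o i
    | zero => simp [RespectsLie]
    | add y z _ _ hy hz =>
      rw [RespectsLie] at *
      simp only [map_add, LinearMap.add_apply, lie_add, ← hy, ← hz]
      abel
    | smul r y _ hy =>
      rw [RespectsLie] at *
      simp only [map_smul, LinearMap.smul_apply, lie_smul, ← hy, smul_sub]
  induction b.mem_span x using Submodule.span_induction with
  | mem x hx =>
    obtain ⟨i, rfl⟩ := hx
    exact key' i
  | zero => simp [RespectsLie]
  | add x z _ _ hy hz =>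
    rw [RespectsLie] at *
    simp only [map_add, LinearMap.add_apply, add_lie, ← hy, ← hz]
    abel
  | smul r x _ hy =>
    rw [RespectsLie] at *
    simp only [map_smul, LinearMap.smul_apply, smul_lie, ← hy, smul_sub]

lemma respectsLie_of_le {l μ : I} {N : Multiset I} (hμ : ∀ ν ∈ N, μ ≤ ν) (hl : μ ≤ l) :
    RespectsLie b k (b (some l)) (b (some μ)) (Finsupp.single N 1) := by
  rcases hl.eq_or_lt with rfl | hl
  · simp [RespectsLie]
  · rw [RespectsLie, rep_some, rep_some, op_comm_of_lt b k hμ hl, add_sub_cancel_left]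

variable (b k) in
-- Induction on length. If one of the two indices is at most the least element ν of N, the relation
-- is built into the recursion. Otherwise N = νQ, and the relation is carried from the shorter Q
-- past ν by the Jacobi identity.
lemma respectsLie_single (hc : ∀ x : L, ⁅b none, x⁆ = 0) (p : ℕ) :
    ∀ N : Multiset I, Multiset.card N ≤ p → ∀ l μ : I,
      RespectsLie b k (b (some l)) (b (some μ)) (Finsupp.single N 1) := by
  have zero : ∀ (l μ : I), RespectsLie b k (b (some l)) (b (some μ)) (Finsupp.single 0 1) :=
    fun l μ => by
      rcases le_total μ l with h | h
      · exact respectsLie_of_le (by simp) h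
      · exact (respectsLie_of_le (by simp) h).symm
  induction p with
  | zero =>
    intro N hN
    obtain rfl : N = 0 := by simpa using hN
    exact zero
  | succ p ih =>
    intro N hN l μ
    by_cases hN0 : N = 0
    · subst hN0
      exact zero l μ
    obtain ⟨⟨ν, Q⟩, rfl, hν⟩ := exists_least_cons hN0
    simp only at hν hN ⊢
    have hν' : ∀ τ, τ ≤ ν → ∀ ξ ∈ ν ::ₘ Q, τ ≤ ξ := fun τ hτ ξ hξ => by
      rcases Multiset.mem_cons.1 hξ with rfl | hξ
      · exact hτ
      · exact hτ.trans (hν ξ hξ)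
    have hQ : Multiset.card Q ≤ p := by simpa using hN
    rcases le_or_gt l ν with hl | hl
    · rcases le_total μ l with h | h
      · exact respectsLie_of_le (hν' _ (h.trans hl)) h
      · exact (respectsLie_of_le (hν' _ hl) h).symm
    rcases le_or_gt μ ν with hm | hm
    · exact respectsLie_of_le (hν' _ hm) (hm.trans hl.le)
    have IH : ∀ (x y : L) (v : Multiset I →₀ R), v ∈ filt R I p → RespectsLie b k x y v :=
      fun x y v hv => respectsLie_of_filt
        (fun M hM => respectsLie_of_basis hc (fun l μ => ih M hM l μ) x y) hv
    have hz : Finsupp.single Q (1 : R) ∈ filt R I p := single_mem_filt hQ 1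
    -- The bracket with `b ν` is respected on `b τ · Q` for every `τ > ν`.
    have step : ∀ τ ξ : I, ν < τ → ν < ξ → RespectsLie b k (b (some ξ)) (b (some ν))
        (rep b k (b (some τ)) (Finsupp.single Q 1)) := by
      intro τ ξ hτ hξ
      have e : rep b k (b (some τ)) (Finsupp.single Q 1) = Finsupp.single (τ ::ₘ Q) 1 +
          (op b k τ (Finsupp.single Q 1) - Finsupp.single (τ ::ₘ Q) 1) := by
        rw [rep_some]; abel
      rw [e]
      refine (respectsLie_of_le ?_ hξ.le).add
        (IH _ _ _ (filt_mono hQ (corrBound b k p Q τ hQ)))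
      intro ζ hζ
      rcases Multiset.mem_cons.1 hζ with rfl | hζ
      · exact hτ.le
      · exact hν ζ hζ
    have hνQ : Finsupp.single (ν ::ₘ Q) (1 : R) = rep b k (b (some ν)) (Finsupp.single Q 1) := by
      rw [rep_some, op_single_of_le b k hν]
    -- Moves ν to the far left. The two middle terms are exchanged by τ ↔ ξ, so they cancel in the
    -- commutator.
    have expand : ∀ τ ξ : I, ν < τ → ν < ξ →
        rep b k (b (some ξ)) (rep b k (b (some τ)) (Finsupp.single (ν ::ₘ Q) 1)) =
          rep b k (b (some ν)) (rep b k (b (some ξ)) (rep b k (b (some τ)) (Finsupp.single Q 1))) +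
          rep b k ⁅b (some ξ), b (some ν)⁆ (rep b k (b (some τ)) (Finsupp.single Q 1)) +
          rep b k ⁅b (some τ), b (some ν)⁆ (rep b k (b (some ξ)) (Finsupp.single Q 1)) +
          rep b k ⁅b (some ξ), ⁅b (some τ), b (some ν)⁆⁆ (Finsupp.single Q 1) := by
      intro τ ξ hτ hξ
      have h₁ := sub_eq_iff_eq_add.1 (IH (b (some τ)) (b (some ν)) _ hz)
      have h₂ := sub_eq_iff_eq_add.1 (step τ ξ hτ hξ)
      have h₃ := sub_eq_iff_eq_add.1 (IH (b (some ξ)) ⁅b (some τ), b (some ν)⁆ _ hz)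
      rw [hνQ, h₁, map_add, h₂, h₃]
      abel
    have h₄ := sub_eq_iff_eq_add.1 (IH (b (some l)) (b (some μ)) _ hz)
    have h₅ := sub_eq_iff_eq_add.1 (IH ⁅b (some l), b (some μ)⁆ (b (some ν)) _ hz)
    -- The surviving double brackets match [[l, μ], ν] by Jacobi, which is `lie_lie`.
    rw [RespectsLie, expand μ l hm hl, expand l μ hl hm, h₄, hνQ, h₅, lie_lie, map_add, map_sub,
      LinearMap.sub_apply]
    abel

variable (b k) in
/-- The ordered Poincaré–Birkhoff–Witt representation: the central basis vector `b none` acts by the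
scalar `k`. -/
def repHom (hc : ∀ x : L, ⁅b none, x⁆ = 0) : L →ₗ⁅R⁆ Module.End R (Multiset I →₀ R) where
  toLinearMap := rep b k
  map_lie' {x y} := by
    refine Finsupp.lhom_ext' fun M => LinearMap.ext_ring ?_
    have := respectsLie_of_basis hc (fun l μ => respectsLie_single b k hc _ M le_rfl l μ) x y
    exact Eq.symm this

/-- An increasing product of basis vectors applied to `1` is the corresponding monomial. -/
lemma prod_op_single_zero (s : List I) (hs : s.Pairwise (· ≤ ·)) :
    (s.map fun l => op b k l).prod (Finsupp.single 0 1) = Finsupp.single (s : Multiset I) 1 := by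
  induction s with
  | nil => simp
  | cons l s ih =>
    rw [List.pairwise_cons] at hs
    rw [List.map_cons, List.prod_cons, Module.End.mul_apply, ih hs.2,
      op_single_of_le b k (by simpa using hs.1)]
    rfl

end OrderedPBW

end

noncomputable section

set_option linter.unusedSectionVars false

namespace TwistedAffine

attribute [local instance] LieRing.ofAssociativeRing

universe u v

/-! ### A basis of ĝ[σ], and linear independence of the ordered monomials. -/

section HatBasis

variable {𝔤 : Type u} [LieRing 𝔤] [LieAlgebra ℂ 𝔤] {T : ℕ} [NeZero T] (D : Datum 𝔤 T)

/-- The projection of the central extension onto the loop algebra, seen as `ℤ →₀ 𝔤`. -/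
def Datum.coverLoop : D.Cover →ₗ[ℂ] ℤ →₀ 𝔤 :=
  (LieAlgebra.LoopAlgebra.toFinsupp ℂ ℤ 𝔤).toLinearMap ∘ₗ
    { toFun := fun z => ((LieAlgebra.ofProd D.cocycle).symm z).1
      map_add' := fun _ _ => rfl
      map_smul' := fun _ _ => rfl }

/-- The coefficient of `c` of an element of the central extension. -/
def Datum.coverCentral : D.Cover →ₗ[ℂ] ℂ :=
  (TrivialLieModule.equiv ℂ _ ℂ).toLinearMap ∘ₗ
    { toFun := fun z => ((LieAlgebra.ofProd D.cocycle).symm z).2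
      map_add' := fun _ _ => rfl
      map_smul' := fun _ _ => rfl }

lemma Datum.coverLoop_loop (j : ℤ) (x : 𝔤) :
    D.coverLoop (D.loop j x) = Finsupp.single j x :=
  LieAlgebra.LoopAlgebra.toFinsupp_single_tmul ℂ ℤ 𝔤 j x

lemma Datum.coverCentral_loop (j : ℤ) (x : 𝔤) : D.coverCentral (D.loop j x) = 0 := rfl

lemma Datum.coverCentral_c : D.coverCentral D.c = 1 := rfl

/-- `x ↦ x(j/T)` as a linear map into `ĝ[σ]`. -/
def Datum.hatLoopₗ (j : ℤ) : D.component (j : ZMod T) →ₗ[ℂ] D.hat where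
  toFun := D.hatLoop j
  map_add' x y := Subtype.ext <| by
    change D.loop j (x + y) = D.loop j x + D.loop j y
    rw [loop, loop, loop, TensorProduct.tmul_add, ← LieAlgebra.of_add, Prod.mk_add_mk, add_zero]
  map_smul' r x := Subtype.ext <| by
    change D.loop j (r • x) = r • D.loop j x
    rw [loop, loop, TensorProduct.tmul_smul, ← LieAlgebra.of_smul, Prod.smul_mk, smul_zero]

variable {D} {ι : ZMod T → Type v} (B : ∀ j, Module.Basis (ι j) ℂ (D.component j))

/-- The family consisting of `c` and the elements of `B̄`. -/
def hatFamily : Option (Part ι) → D.hat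
  | none => D.hatC
  | some b => D.hatLoop b.degree (B _ b.color)

/-- The elements of B̄ stay independent after projection to the loop algebra, where distinct degrees
occupy distinct coordinates; `c` is separated from their span by its own coefficient. -/
lemma linearIndependent_hatFamily : LinearIndependent ℂ (hatFamily B) := by
  rw [linearIndependent_option]
  constructor
  · refine LinearIndependent.of_comp (D.coverLoop ∘ₗ D.hat.toSubmodule.subtype) ?_
    have h := Finsupp.linearIndependent_single (R := ℂ)
      (fun (j : ℤ) (c : ι (j : ZMod T)) => ((B (j : ZMod T) c : D.component _) : 𝔤))
      (fun j => (B (j : ZMod T)).linearIndependent.map' (Submodule.subtype _)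
        (Submodule.ker_subtype _))
    have hinj : Function.Injective
        (fun b : Part ι => (⟨b.degree, b.color⟩ : Σ j : ℤ, ι (j : ZMod T))) := by
      rintro ⟨i, a⟩ ⟨j, b⟩ hab
      simpa using hab
    have e : (D.coverLoop ∘ₗ D.hat.toSubmodule.subtype) ∘ hatFamily B ∘ some =
        (fun ix : Σ j : ℤ, ι (j : ZMod T) =>
          Finsupp.single ix.1 ((B (ix.1 : ZMod T) ix.2 : D.component _) : 𝔤)) ∘
        fun b : Part ι => ⟨b.degree, b.color⟩ := funext fun b => D.coverLoop_loop _ _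
    rw [e]
    exact h.comp _ hinj
  · intro hmem
    have hle : Submodule.span ℂ (Set.range (hatFamily B ∘ some)) ≤
        LinearMap.ker (D.coverCentral ∘ₗ D.hat.toSubmodule.subtype) := by
      rw [Submodule.span_le]
      rintro _ ⟨b, rfl⟩
      exact D.coverCentral_loop b.degree (B _ b.color)
    have h0 : D.coverCentral D.c = 0 := hle hmem
    rw [D.coverCentral_c] at h0
    exact one_ne_zero h0

lemma hatLoop_mem_span (j : ℤ) (x : D.component (j : ZMod T)) :
    D.hatLoop j x ∈ Submodule.span ℂ (Set.range (hatFamily B)) := by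
  have hle : (⊤ : Submodule ℂ (D.component (j : ZMod T))) ≤
      (Submodule.span ℂ (Set.range (hatFamily B))).comap (D.hatLoopₗ j) := by
    rw [← (B (j : ZMod T)).span_eq, Submodule.span_le]
    rintro _ ⟨c, rfl⟩
    exact Submodule.subset_span ⟨some ⟨j, c⟩, rfl⟩
  exact hle (Submodule.mem_top (x := x))

lemma span_hatFamily : ⊤ ≤ Submodule.span ℂ (Set.range (hatFamily B)) := by
  rintro ⟨z, hz⟩ -
  have hle : Submodule.span ℂ D.generators ≤
      (Submodule.span ℂ (Set.range (hatFamily B))).map D.hat.toSubmodule.subtype := by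
    rw [Submodule.span_le]
    rintro _ (⟨j, x, hx, rfl⟩ | rfl)
    · exact ⟨_, hatLoop_mem_span B j ⟨x, hx⟩, rfl⟩
    · exact ⟨_, Submodule.subset_span ⟨none, rfl⟩, rfl⟩
  obtain ⟨w, hw, hwz⟩ := hle hz
  obtain rfl : w = ⟨z, hz⟩ := Subtype.ext hwz
  exact hw

/-- The basis `B̄ ∪ {c}` of `ĝ[σ]`. -/
def hatBasis : Module.Basis (Option (Part ι)) ℂ D.hat :=
  Module.Basis.mk (linearIndependent_hatFamily B) (span_hatFamily B)

lemma hatBasis_none : hatBasis B none = D.hatC := by simp [hatBasis, hatFamily]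

lemma hatBasis_some (b : Part ι) :
    hatBasis B (some b) = D.hatLoop b.degree (B _ b.color) := by simp [hatBasis, hatFamily]

lemma hatBasis_central (x : D.hat) : ⁅hatBasis B none, x⁆ = 0 := by
  rw [hatBasis_none]
  exact Subtype.ext (D.c_lie x)

variable [LinearOrder (Part ι)]

/-- The action of `𝒰^σ` on polynomials in the elements of `B̄`. -/
def envRep : D.Env →ₐ[ℂ] Module.End ℂ (Multiset (Part ι) →₀ ℂ) :=
  RingQuot.liftAlgHom ℂ (s := D.LevelRel)
    ⟨UniversalEnvelopingAlgebra.lift ℂ (OrderedPBW.repHom (hatBasis B) D.k (hatBasis_central B)),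
    by
      rintro _ _ ⟨⟩
      rw [UniversalEnvelopingAlgebra.lift_ι_apply, AlgHom.commutes, ← hatBasis_none B]
      exact OrderedPBW.rep_none _ _⟩

lemma envRep_gen (b : Part ι) :
    envRep B (D.gen b.degree (B _ b.color)) = OrderedPBW.op (hatBasis B) D.k b := by
  refine (RingQuot.liftAlgHom_mkAlgHom_apply ℂ _ _ _).trans ?_
  rw [UniversalEnvelopingAlgebra.lift_ι_apply, ← hatBasis_some B]
  exact OrderedPBW.rep_some _ _ _

lemma envRep_monomial (π : ColoredPartition ι) :
    envRep B (monomial B π) (Finsupp.single 0 1) = Finsupp.single π.parts 1 := by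
  rw [monomial, map_list_prod, List.map_map]
  have : (⇑(envRep B) ∘ fun b : Part ι => D.gen b.degree (B _ b.color)) =
      fun b => OrderedPBW.op (hatBasis B) D.k b := funext fun b => envRep_gen B b
  rw [this, OrderedPBW.prod_op_single_zero _ (Multiset.pairwise_sort _ _), Multiset.sort_eq]

/-- The Poincaré–Birkhoff–Witt theorem for `𝒰^σ`: ordered monomials are linearly independent. -/
theorem linearIndependent_monomial :
    LinearIndependent ℂ (fun π : ColoredPartition ι => monomial B π) := by
  -- Evaluation at the polynomial 1 sends u(π) to the basis vector `π.parts`.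
  refine LinearIndependent.of_comp
    ((LinearMap.applyₗ (Finsupp.single 0 1)) ∘ₗ (envRep B).toLinearMap) ?_
  have h := (Finsupp.basisSingleOne (R := ℂ) (ι := Multiset (Part ι))).linearIndependent.comp
    ColoredPartition.parts (fun π κ h => ColoredPartition.ext h)
  convert h using 1
  funext π
  simpa using envRep_monomial B π

end HatBasis

/-! ### Straightening words into ordered monomials. -/

section Spanning

variable {𝔤 : Type u} [LieRing 𝔤] [LieAlgebra ℂ 𝔤] {T : ℕ} [NeZero T] {D : Datum 𝔤 T}

variable (D) in
/-- `x ↦ x(j/T)` as a linear map into `𝒰^σ`. -/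
def Datum.genₗ (j : ℤ) : D.component (j : ZMod T) →ₗ[ℂ] D.Env :=
  (RingQuot.mkAlgHom ℂ D.LevelRel).toLinearMap ∘ₗ
    (UniversalEnvelopingAlgebra.ι ℂ : D.hat →ₗ⁅ℂ⁆ _).toLinearMap ∘ₗ D.hatLoopₗ j

lemma Datum.gen_mul_gen (i j : ℤ) (x : D.component (i : ZMod T)) (y : D.component (j : ZMod T)) :
    D.gen i x * D.gen j y - D.gen j y * D.gen i x =
      D.gen (i + j) ⟨⁅(x : 𝔤), (y : 𝔤)⁆, by
        rw [Int.cast_add]; exact D.lie_mem_component x.2 y.2⟩ +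
      (if i + j = 0 then ((i : ℂ) / T) * D.form x y * D.k else 0) • 1 := by
  have hlie : ⁅D.hatLoop i x, D.hatLoop j y⁆ = D.hatLoop (i + j) ⟨⁅(x : 𝔤), (y : 𝔤)⁆, by
        rw [Int.cast_add]; exact D.lie_mem_component x.2 y.2⟩ +
      (if i + j = 0 then ((i : ℂ) / T) * D.form x y else 0) • D.hatC :=
    Subtype.ext (D.lie_loop i j x y)
  have hc : RingQuot.mkAlgHom ℂ D.LevelRel (UniversalEnvelopingAlgebra.ι ℂ D.hatC) =
      algebraMap ℂ _ D.k := by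
    rw [RingQuot.mkAlgHom_rel ℂ Datum.LevelRel.level, AlgHom.commutes]
  have h := congrArg (fun z => RingQuot.mkAlgHom ℂ D.LevelRel (UniversalEnvelopingAlgebra.ι ℂ z))
    hlie
  simp only [LieHom.map_lie, map_add, map_smul, LieRing.of_associative_ring_bracket, map_sub,
    map_mul, hc] at h
  refine h.trans (congrArg₂ _ rfl ?_)
  rw [Algebra.algebraMap_eq_smul_one, smul_smul]
  split_ifs
  · rfl
  · rw [zero_mul]; rfl

variable {ι : ZMod T → Type v} (B : ∀ j, Module.Basis (ι j) ℂ (D.component j))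

/-- The product of the elements of `B̄` in a list. -/
def word (l : List (Part ι)) : D.Env := (l.map fun b => D.gen b.degree (B _ b.color)).prod

lemma word_cons (b : Part ι) (l : List (Part ι)) :
    word B (b :: l) = D.gen b.degree (B _ b.color) * word B l := by simp [word]

lemma word_append (l s : List (Part ι)) : word B (l ++ s) = word B l * word B s := by simp [word]

/-- The span of the words of degree `d` with parts of degree in `P`. -/
def words (P : Set ℤ) (d : ℤ) : Submodule ℂ D.Env :=
  Submodule.span ℂ {a | ∃ l : List (Part ι), (∀ b ∈ l, b.degree ∈ P) ∧
    (l.map Part.degree).sum = d ∧ a = word B l}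

/-- The span of the words of length less than `m` and degree `d` with parts of degree in `P`. -/
def wordsLT (P : Set ℤ) (m : ℕ) (d : ℤ) : Submodule ℂ D.Env :=
  Submodule.span ℂ {a | ∃ l : List (Part ι), l.length < m ∧ (∀ b ∈ l, b.degree ∈ P) ∧
    (l.map Part.degree).sum = d ∧ a = word B l}

lemma gen_mem_span (j : ℤ) (x : D.component (j : ZMod T)) :
    D.gen j x ∈ Submodule.span ℂ (Set.range fun c : ι (j : ZMod T) => D.gen j (B _ c)) := by
  have hle : (⊤ : Submodule ℂ (D.component (j : ZMod T))) ≤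
      (Submodule.span ℂ (Set.range fun c : ι (j : ZMod T) => D.gen j (B _ c))).comap
        (D.genₗ j) := by
    rw [← (B (j : ZMod T)).span_eq, Submodule.span_le]
    rintro _ ⟨c, rfl⟩
    exact Submodule.subset_span ⟨c, rfl⟩
  exact hle (Submodule.mem_top (x := x))

lemma gen_mul_mem_wordsLT {P : Set ℤ} {m : ℕ} {d j : ℤ} (hj : j ∈ P)
    (x : D.component (j : ZMod T)) {a : D.Env} (ha : a ∈ wordsLT B P m d) :
    D.gen j x * a ∈ wordsLT B P (m + 1) (j + d) := by
  have hmem := Submodule.mul_mem_mul (gen_mem_span B j x) ha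
  rw [wordsLT, Submodule.span_mul_span] at hmem
  refine Submodule.span_mono ?_ hmem
  rintro _ ⟨_, ⟨c, rfl⟩, _, ⟨l, hl, hP, rfl, rfl⟩, rfl⟩
  refine ⟨⟨j, c⟩ :: l, by simpa using hl, ?_, by simp, by rw [word_cons]⟩
  rintro b hb
  rcases List.mem_cons.1 hb with rfl | hb
  · exact hj
  · exact hP b hb

lemma word_mem_wordsLT {P : Set ℤ} {l : List (Part ι)} (hl : ∀ b ∈ l, b.degree ∈ P) {m : ℕ}
    (hm : l.length < m) : word B l ∈ wordsLT B P m (l.map Part.degree).sum :=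
  Submodule.subset_span ⟨l, hm, hl, rfl, rfl⟩

/-- Permuting the factors of a word changes it by shorter words. -/
lemma word_sub_word_mem {P : Set ℤ} (hadd : ∀ i ∈ P, ∀ j ∈ P, i + j ∈ P) {l s : List (Part ι)}
    (h : l.Perm s) (hl : ∀ b ∈ l, b.degree ∈ P) :
    word B l - word B s ∈ wordsLT B P l.length (l.map Part.degree).sum := by
  induction h with
  | nil => simp
  | cons b h ih =>
    rw [word_cons, word_cons, ← mul_sub, List.map_cons, List.sum_cons, List.length_cons]
    exact gen_mul_mem_wordsLT B (hl b (by simp)) _ (ih fun a ha => hl a (by simp [ha]))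
  -- The commutator of two adjacent letters is a combination of single letters of the summed degree,
  -- in `P` by `hadd`, plus a scalar. The word loses one letter or two.
  | swap a b l =>
    have ha : a.degree ∈ P := hl a (by simp)
    have hb : b.degree ∈ P := hl b (by simp)
    have hl' : ∀ c ∈ l, c.degree ∈ P := fun c hc => hl c (by simp [hc])
    rw [word_cons, word_cons, word_cons, word_cons, ← mul_assoc, ← mul_assoc, ← sub_mul,
      D.gen_mul_gen, add_mul, smul_mul_assoc, one_mul]
    simp only [List.map_cons, List.sum_cons, List.length_cons, ← add_assoc]
    refine add_mem (gen_mul_mem_wordsLT B (hadd _ hb _ ha) _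
      (word_mem_wordsLT B hl' (Nat.lt_succ_self _))) ?_
    -- The scalar occurs only when the two degrees cancel, so dropping both letters keeps the total
    -- degree.
    split_ifs with h0
    · rw [h0, zero_add]
      exact Submodule.smul_mem _ _ (word_mem_wordsLT B hl' (by omega))
    · rw [zero_smul]
      exact zero_mem _
  | trans h₁ h₂ ih₁ ih₂ =>
    have h := add_mem (ih₁ hl)
      (h₁.length_eq ▸ (h₁.map Part.degree).sum_eq ▸ ih₂ fun b hb => hl b (h₁.mem_iff.2 hb))
    rwa [sub_add_sub_cancel] at h

variable [LinearOrder (Part ι)]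

/-- The span of the ordered monomials of degree `d` with parts of degree in `P`. -/
def monomials (P : Set ℤ) (d : ℤ) : Submodule ℂ D.Env :=
  Submodule.span ℂ {a | ∃ π : ColoredPartition ι, (∀ b ∈ π.parts, b.degree ∈ P) ∧
    π.degree = d ∧ a = monomial B π}

lemma monomial_eq_word (π : ColoredPartition ι) :
    monomial B π = word B (π.parts.sort (· ≤ ·)) := rfl

lemma degree_coe (l : List (Part ι)) :
    (⟨l⟩ : ColoredPartition ι).degree = (l.map Part.degree).sum := by
  simp [ColoredPartition.degree]

/-- Sort the word; the error consists of shorter words, handled by induction. A general `P` closed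
under addition serves both for all degrees and for the positive degrees alone. -/
lemma word_mem_monomials {P : Set ℤ} (hadd : ∀ i ∈ P, ∀ j ∈ P, i + j ∈ P) (m : ℕ) :
    ∀ l : List (Part ι), l.length < m → (∀ b ∈ l, b.degree ∈ P) →
      word B l ∈ monomials B P (l.map Part.degree).sum := by
  induction m with
  | zero => intro l hl; omega
  | succ m ih =>
    intro l hl hP
    have hperm : l.Perm ((l : Multiset (Part ι)).sort (· ≤ ·)) :=
      Multiset.coe_eq_coe.1 (Multiset.sort_eq _ _).symm
    rw [← sub_add_cancel (word B l) (word B ((l : Multiset (Part ι)).sort (· ≤ ·)))]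
    refine add_mem ?_ (Submodule.subset_span ⟨⟨l⟩, by simpa using hP, degree_coe l, rfl⟩)
    have hle : wordsLT B P l.length (l.map Part.degree).sum ≤
        monomials B P (l.map Part.degree).sum := by
      rw [wordsLT, Submodule.span_le]
      rintro _ ⟨s, hs, hsP, hsd, rfl⟩
      rw [← hsd]
      exact ih s (by omega) hsP
    exact hle (word_sub_word_mem B hadd hperm hP)

lemma homog_le_words (n : ℤ) : D.homog n ≤ words B Set.univ n := by
  rw [Datum.homog, Submodule.span_le]
  rintro _ ⟨l, hl, rfl⟩
  induction l generalizing n with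
  | nil => exact Submodule.subset_span ⟨[], by simp, by simpa using hl, rfl⟩
  | cons b l ih =>
    rw [List.map_cons, List.prod_cons]
    have hmem := Submodule.mul_mem_mul (gen_mem_span B b.1 b.2) (ih _ rfl)
    rw [words, Submodule.span_mul_span] at hmem
    refine Submodule.span_mono ?_ hmem
    rintro _ ⟨_, ⟨c, rfl⟩, _, ⟨s, -, hs, rfl⟩, rfl⟩
    refine ⟨⟨b.1, c⟩ :: s, by simp, ?_, by rw [word_cons]⟩
    rw [List.map_cons, List.sum_cons, hs, ← hl]
    simp

lemma homog_le_monomials (n : ℤ) : D.homog n ≤ monomials B Set.univ n := by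
  refine (homog_le_words B n).trans ?_
  rw [words, Submodule.span_le]
  rintro _ ⟨l, hl, rfl, rfl⟩
  exact word_mem_monomials B (by simp) _ l (Nat.lt_succ_self _) hl

lemma monomial_mem_homog (π : ColoredPartition ι) : monomial B π ∈ D.homog π.degree :=
  monomial_mem B ⟨π, rfl⟩

lemma mul_mem_homog {m n : ℤ} {a b : D.Env} (ha : a ∈ D.homog m) (hb : b ∈ D.homog n) :
    a * b ∈ D.homog (m + n) := by
  have hmem := Submodule.mul_mem_mul ha hb
  rw [Datum.homog, Datum.homog, Submodule.span_mul_span] at hmem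
  refine Submodule.span_mono ?_ hmem
  rintro _ ⟨_, ⟨l, rfl, rfl⟩, _, ⟨s, rfl, rfl⟩, rfl⟩
  exact ⟨l ++ s, by simp, by simp⟩

/-! ### Positive parts of partitions and the subspaces V_p(n). -/

/-- The sub-partition of the parts of positive degree. -/
def ColoredPartition.positivePart (π : ColoredPartition ι) : ColoredPartition ι :=
  ⟨π.parts.filter fun b => 0 < b.degree⟩

/-- The sub-partition of the parts of non-positive degree. -/
def ColoredPartition.nonposPart (π : ColoredPartition ι) : ColoredPartition ι :=
  ⟨π.parts.filter fun b => ¬ 0 < b.degree⟩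

lemma degree_mul (π κ : ColoredPartition ι) : (π * κ).degree = π.degree + κ.degree := by
  change ((π.parts + κ.parts).map Part.degree).sum = _
  rw [Multiset.map_add, Multiset.sum_add]
  rfl

lemma nonposPart_mul_positivePart (π : ColoredPartition ι) :
    π.nonposPart * π.positivePart = π := by
  refine ColoredPartition.ext ?_
  change π.parts.filter (fun b => ¬ 0 < b.degree) + π.parts.filter (fun b => 0 < b.degree) = _
  rw [add_comm, Multiset.filter_add_not]

lemma degree_nonposPart_le (π : ColoredPartition ι) : π.nonposPart.degree ≤ 0 := by
  refine Multiset.sum_induction (· ≤ 0) _ (fun _ _ => add_nonpos) le_rfl fun a ha => ?_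
  obtain ⟨b, hb, rfl⟩ := Multiset.mem_map.1 ha
  exact not_lt.1 (Multiset.mem_filter.1 hb).2

lemma degree_positivePart_nonneg (π : ColoredPartition ι) : 0 ≤ π.positivePart.degree := by
  refine Multiset.sum_nonneg fun a ha => ?_
  obtain ⟨b, hb, rfl⟩ := Multiset.mem_map.1 ha
  exact (Multiset.mem_filter.1 hb).2.le

lemma monomial_mul {π κ : ColoredPartition ι} (h : ∀ a ∈ π.parts, ∀ b ∈ κ.parts, a ≤ b) :
    monomial B (π * κ) = monomial B π * monomial B κ := by
  rw [monomial_eq_word, monomial_eq_word, monomial_eq_word, ← word_append]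
  congr 1
  refine List.Perm.eq_of_pairwise' (Multiset.pairwise_sort _ (· ≤ ·)) ?_ ?_
  · rw [List.pairwise_append]
    exact ⟨Multiset.pairwise_sort _ _, Multiset.pairwise_sort _ _, fun a ha b hb =>
      h a ((Multiset.mem_sort _).1 ha) b ((Multiset.mem_sort _).1 hb)⟩
  · refine Multiset.coe_eq_coe.1 ?_
    rw [Multiset.sort_eq, ← Multiset.coe_add, Multiset.sort_eq, Multiset.sort_eq]
    rfl

lemma monomial_nonpos_mul_pos (hP : ∀ a b : Part ι, a.degree < b.degree → a < b)
    {π κ : ColoredPartition ι} (hπ : ∀ a ∈ π.parts, a.degree ≤ 0)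
    (hκ : ∀ b ∈ κ.parts, 0 < b.degree) :
    monomial B (π * κ) = monomial B π * monomial B κ :=
  monomial_mul B fun a ha b hb => (hP a b ((hπ a ha).trans_lt (hκ b hb))).le

lemma degree_le_of_mem_nonposPart {π : ColoredPartition ι} : ∀ a ∈ π.nonposPart.parts,
    a.degree ≤ 0 := fun _ ha => not_lt.1 (Multiset.mem_filter.1 ha).2

lemma degree_pos_of_mem_positivePart {π : ColoredPartition ι} : ∀ a ∈ π.positivePart.parts,
    0 < a.degree := fun _ ha => (Multiset.mem_filter.1 ha).2

lemma monomial_eq_mul (hP : ∀ a b : Part ι, a.degree < b.degree → a < b)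
    (π : ColoredPartition ι) :
    monomial B π = monomial B π.nonposPart * monomial B π.positivePart := by
  rw [← monomial_nonpos_mul_pos B hP degree_le_of_mem_nonposPart degree_pos_of_mem_positivePart,
    nonposPart_mul_positivePart]

/-- The span of the monomials of degree `n` with positive part of degree at least `q`. -/
def monomialsPos (q n : ℤ) : Submodule ℂ D.Env :=
  Submodule.span ℂ {a | ∃ π : ColoredPartition ι, π.degree = n ∧ q ≤ π.positivePart.degree ∧
    a = monomial B π}

lemma positivePart_mul {π κ : ColoredPartition ι} (hπ : ∀ a ∈ π.parts, a.degree ≤ 0)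
    (hκ : ∀ b ∈ κ.parts, 0 < b.degree) : (π * κ).positivePart = κ := by
  refine ColoredPartition.ext ?_
  change (π.parts + κ.parts).filter (fun b => 0 < b.degree) = _
  rw [Multiset.filter_add, Multiset.filter_eq_nil.2 fun a ha => (hπ a ha).not_gt,
    Multiset.filter_eq_self.2 hκ, zero_add]

/-- The non-positive part of τ already stands in front, so only the product of the positive part of
τ with κ needs sorting. Its degree is at least that of κ. -/
lemma monomial_mul_positive_mem (hP : ∀ a b : Part ι, a.degree < b.degree → a < b)
    (τ κ : ColoredPartition ι) (hκ : ∀ b ∈ κ.parts, 0 < b.degree) :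
    monomial B τ * monomial B κ ∈ monomialsPos B κ.degree (τ.degree + κ.degree) := by
  rw [monomial_eq_mul B hP τ, mul_assoc, monomial_eq_word B τ.positivePart, monomial_eq_word B κ,
    ← word_append]
  have hdeg : ∀ π : ColoredPartition ι,
      ((π.parts.sort (· ≤ ·)).map Part.degree).sum = π.degree := fun π => by
    rw [← degree_coe, Multiset.sort_eq]
  -- Positive degrees are closed under addition, so sorting leaves only positive parts, with the
  -- same total degree.
  have hmem := word_mem_monomials B (P := {j | 0 < j})
    (fun i hi j hj => add_pos (Set.mem_ofPred.1 hi) (Set.mem_ofPred.1 hj)) _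
    (τ.positivePart.parts.sort (· ≤ ·) ++ κ.parts.sort (· ≤ ·)) (Nat.lt_succ_self _) (by
      intro b hb
      rcases List.mem_append.1 hb with hb | hb
      · exact degree_pos_of_mem_positivePart b ((Multiset.mem_sort _).1 hb)
      · exact hκ b ((Multiset.mem_sort _).1 hb))
  rw [List.map_append, List.sum_append, hdeg, hdeg] at hmem
  have hτ : τ.degree = τ.nonposPart.degree + τ.positivePart.degree := by
    rw [← degree_mul, nonposPart_mul_positivePart]
  suffices monomials B {j | 0 < j} (τ.positivePart.degree + κ.degree) ≤
      (monomialsPos B κ.degree (τ.degree + κ.degree)).comap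
        (LinearMap.mulLeft ℂ (monomial B τ.nonposPart)) from this hmem
  rw [monomials, Submodule.span_le]
  rintro _ ⟨ρ, hρ, hρd, rfl⟩
  refine Submodule.subset_span ⟨τ.nonposPart * ρ, ?_, ?_, ?_⟩
  · rw [degree_mul, hρd, hτ, add_assoc]
  · rw [positivePart_mul degree_le_of_mem_nonposPart hρ, hρd]
    exact le_add_of_nonneg_left (degree_positivePart_nonneg τ)
  · exact (monomial_nonpos_mul_pos B hP degree_le_of_mem_nonposPart hρ).symm

lemma mul_monomial_positive_mem (hP : ∀ a b : Part ι, a.degree < b.degree → a < b)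
    {m : ℤ} {a : D.Env} (ha : a ∈ D.homog m)
    (κ : ColoredPartition ι) (hκ : ∀ b ∈ κ.parts, 0 < b.degree) :
    a * monomial B κ ∈ monomialsPos B κ.degree (m + κ.degree) := by
  suffices monomials B Set.univ m ≤ (monomialsPos B κ.degree (m + κ.degree)).comap
      (LinearMap.mulRight ℂ (monomial B κ)) from this (homog_le_monomials B m ha)
  rw [monomials, Submodule.span_le]
  rintro _ ⟨τ, -, rfl, rfl⟩
  exact monomial_mul_positive_mem B hP τ κ hκ

lemma monomialsPos_anti {q r : ℤ} (h : q ≤ r) (n : ℤ) : monomialsPos B r n ≤ monomialsPos B q n :=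
  Submodule.span_mono fun _ ⟨π, hπ, hr, ha⟩ => ⟨π, hπ, h.trans hr, ha⟩

/-- `V_p(n/T)` lies in the span of the monomials whose positive part has degree at least `p`. -/
theorem nbhd_le_monomialsPos (hP : ∀ a b : Part ι, a.degree < b.degree → a < b) (p : ℕ) (n : ℤ) :
    D.nbhd p n ≤ monomialsPos B (p * T) n := by
  refine iSup₂_le fun i hi => Submodule.mul_le.2 fun a ha c hc => ?_
  suffices monomials B Set.univ i ≤ (monomialsPos B (p * T) n).comap
      (LinearMap.mulLeft ℂ a) from this (homog_le_monomials B i hc)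
  rw [monomials, Submodule.span_le]
  rintro _ ⟨κ, -, rfl, rfl⟩
  change a * monomial B κ ∈ monomialsPos B (p * T) n
  -- The non-positive part of κ is absorbed into the left factor. Its degree is at most 0, so the
  -- positive part that remains has degree at least |κ| ≥ p.
  rw [monomial_eq_mul B hP κ, ← mul_assoc]
  have hκ : κ.degree = κ.nonposPart.degree + κ.positivePart.degree := by
    rw [← degree_mul, nonposPart_mul_positivePart]
  have h := mul_monomial_positive_mem B hP (mul_mem_homog ha (monomial_mem_homog B κ.nonposPart))
    κ.positivePart degree_pos_of_mem_positivePart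
  have hn : n - κ.degree + κ.nonposPart.degree + κ.positivePart.degree = n := by omega
  rw [hn] at h
  refine monomialsPos_anti B ?_ n h
  have := degree_nonposPart_le κ
  omega

/-- Converse to `nbhd_le_monomialsPos`: the factorization into non-positive and positive parts
exhibits the monomial as a product defining V_p. -/
lemma monomial_mem_nbhd (hP : ∀ a b : Part ι, a.degree < b.degree → a < b) {p : ℕ}
    (π : ColoredPartition ι) (h : (p : ℤ) * T ≤ π.positivePart.degree) :
    monomial B π ∈ D.nbhd p π.degree := by
  rw [monomial_eq_mul B hP]
  refine Submodule.mem_iSup_of_mem π.positivePart.degree (Submodule.mem_iSup_of_mem h ?_)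
  have hπ : π.degree = π.nonposPart.degree + π.positivePart.degree := by
    rw [← degree_mul, nonposPart_mul_positivePart]
  refine Submodule.mul_mem_mul ?_ (monomial_mem_homog B _)
  rw [hπ, add_sub_cancel_right]
  exact monomial_mem_homog B _

end Spanning

end TwistedAffine

end

noncomputable section

set_option linter.unusedSectionVars false

namespace TwistedAffine

universe u v

/-! ### Coefficient functionals on the completion. -/

section Coordinates

open UniformSpace Filter Topology

variable {𝔤 : Type u} [LieRing 𝔤] [LieAlgebra ℂ 𝔤] {T : ℕ} [NeZero T] {D : Datum 𝔤 T}
  {ι : ZMod T → Type v} (B : ∀ j, Module.Basis (ι j) ℂ (D.component j)) [LinearOrder (Part ι)]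

variable (D) in
/-- The inclusion of `𝒰^σ(n/T)` into `𝒰^σ`. -/
def Datum.homogIncl (n : ℤ) : D.Homog n →ₗ[ℂ] D.Env := (D.homog n).subtype

lemma Datum.homogIncl_injective (n : ℤ) : Function.Injective (D.homogIncl n) :=
  Subtype.val_injective

lemma linearIndependent_homogMonomial (n : ℤ) :
    LinearIndependent ℂ (fun π : PartitionsOf ι n => homogMonomial B π) :=
  LinearIndependent.of_comp (D.homogIncl n)
    ((linearIndependent_monomial B).comp Subtype.val Subtype.val_injective)

/-- Elements of `𝒰^σ(n/T)` in a span of monomials of degree `n` are in the corresponding span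
in `𝒰^σ(n/T)`. -/
lemma mem_span_homogMonomial {n : ℤ} (Q : ColoredPartition ι → Prop) {a : D.Homog n}
    (ha : D.homogIncl n a ∈ Submodule.span ℂ {x | ∃ π : ColoredPartition ι, π.degree = n ∧ Q π ∧
      x = monomial B π}) :
    a ∈ Submodule.span ℂ {x | ∃ π : PartitionsOf ι n, Q π.1 ∧ x = homogMonomial B π} := by
  have hle : Submodule.span ℂ {x | ∃ π : ColoredPartition ι, π.degree = n ∧ Q π ∧
      x = monomial B π} ≤ (Submodule.span ℂ {x | ∃ π : PartitionsOf ι n, Q π.1 ∧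
        x = homogMonomial B π}).map (D.homogIncl n) := by
    rw [Submodule.span_le]
    rintro _ ⟨π, hπ, hQ, rfl⟩
    exact ⟨homogMonomial B ⟨π, hπ⟩, Submodule.subset_span ⟨⟨π, hπ⟩, hQ, rfl⟩, rfl⟩
  obtain ⟨w, hw, hwa⟩ := hle ha
  obtain rfl := D.homogIncl_injective n hwa
  exact hw

lemma span_homogMonomial (n : ℤ) :
    ⊤ ≤ Submodule.span ℂ (Set.range fun π : PartitionsOf ι n => homogMonomial B π) := by
  intro a _
  have h : D.homogIncl n a ∈ monomials B Set.univ n := homog_le_monomials B n a.2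
  refine Submodule.span_mono ?_ (mem_span_homogMonomial B (fun _ => True)
    (Submodule.span_mono ?_ h))
  · rintro _ ⟨π, -, rfl⟩
    exact ⟨π, rfl⟩
  · rintro _ ⟨π, -, hπ, rfl⟩
    exact ⟨π, hπ, trivial, rfl⟩

/-- The Poincaré–Birkhoff–Witt basis of `𝒰^σ(n/T)`. -/
def homogBasis (n : ℤ) : Module.Basis (PartitionsOf ι n) ℂ (D.Homog n) :=
  Module.Basis.mk (linearIndependent_homogMonomial B n) (span_homogMonomial B n)

lemma homogBasis_apply {n : ℤ} (π : PartitionsOf ι n) :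
    homogBasis B n π = homogMonomial B π := by simp [homogBasis]

/-- V_p lies in the span of monomials of larger positive degree than π. This is what makes the
coefficient functional continuous. -/
lemma coord_eq_zero_of_mem_nbhdIn (hP : ∀ a b : Part ι, a.degree < b.degree → a < b) {n : ℤ}
    {p : ℕ} {π : PartitionsOf ι n} (hπ : π.1.positivePart.degree < p * T) {a : D.Homog n}
    (ha : a ∈ D.nbhdIn p n) : (homogBasis B n).coord π a = 0 := by
  have h := mem_span_homogMonomial B (fun κ => (p : ℤ) * T ≤ κ.positivePart.degree)
    (nbhd_le_monomialsPos B hP p n ha)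
  suffices Submodule.span ℂ {x | ∃ κ : PartitionsOf ι n,
      (p : ℤ) * T ≤ κ.1.positivePart.degree ∧ x = homogMonomial B κ} ≤
      LinearMap.ker ((homogBasis B n).coord π) from this h
  rw [Submodule.span_le]
  rintro _ ⟨κ, hκ, rfl⟩
  have hne : κ ≠ π := by rintro rfl; omega
  rw [SetLike.mem_coe, LinearMap.mem_ker, ← homogBasis_apply]
  simp [Finsupp.single_eq_of_ne' hne]

lemma homogMonomial_mem_nbhdIn (hP : ∀ a b : Part ι, a.degree < b.degree → a < b) {n : ℤ}
    {p : ℕ} {π : PartitionsOf ι n} (hπ : (p : ℤ) * T ≤ π.1.positivePart.degree) :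
    homogMonomial B π ∈ D.nbhdIn p n := by
  have h := monomial_mem_nbhd B hP π.1 hπ
  rw [π.2] at h
  exact h

lemma hasBasis_nhds_zero (n : ℤ) :
    (𝓝 (0 : D.Homog n)).HasBasis (fun p : ℕ => 1 ≤ p) (fun p => (D.nbhdIn p n : Set _)) := by
  refine ⟨fun s => (D.filterBasis n).nhds_zero_hasBasis.mem_iff.trans ⟨?_, ?_⟩⟩
  · rintro ⟨_, ⟨p, hp, rfl⟩, hs⟩
    exact ⟨p, hp, hs⟩
  · rintro ⟨p, hp, hs⟩
    exact ⟨_, ⟨p, hp, rfl⟩, hs⟩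

lemma uniformContinuous_coord (hP : ∀ a b : Part ι, a.degree < b.degree → a < b) {n : ℤ}
    (π : PartitionsOf ι n) : UniformContinuous ((homogBasis B n).coord π) := by
  refine uniformContinuous_of_continuousAt_zero ((homogBasis B n).coord π).toAddMonoidHom ?_
  rw [ContinuousAt, map_zero]
  intro s hs
  -- The extra 1 gives p ≥ 1 and, as T ≥ 1, the strict inequality between the positive degree and
  -- pT.
  refine (hasBasis_nhds_zero n).mem_iff.2 ⟨π.1.positivePart.degree.toNat + 1, by omega, ?_⟩
  intro a ha
  have hlt : π.1.positivePart.degree < ((π.1.positivePart.degree.toNat + 1 : ℕ) : ℤ) * T := by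
    have h1 : (1 : ℤ) ≤ T := by exact_mod_cast NeZero.one_le
    have h2 := Int.self_le_toNat π.1.positivePart.degree
    push_cast
    nlinarith
  have h0 := coord_eq_zero_of_mem_nbhdIn B hP hlt ha
  change (homogBasis B n).coord π a ∈ s
  rw [h0]
  exact mem_of_mem_nhds hs

/-- The coefficient of `u(π)` of an element of the completion. -/
def completedCoord (hP : ∀ a b : Part ι, a.degree < b.degree → a < b) {n : ℤ}
    (π : PartitionsOf ι n) : D.Completed n →ₗ[ℂ] ℂ :=
  { AddMonoidHom.extension ((homogBasis B n).coord π).toAddMonoidHom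
      (uniformContinuous_coord B hP π).continuous with
    map_smul' := fun r x => by
      have hu := uniformContinuous_coord B hP π
      change Completion.extension ((homogBasis B n).coord π) (r • x) =
        r • Completion.extension ((homogBasis B n).coord π) x
      induction x using Completion.induction_on with
      | hp =>
        exact isClosed_eq (Completion.continuous_extension.comp (continuous_const_smul r))
          (Completion.continuous_extension.const_smul r)
      | ih a =>
        rw [← Completion.coe_smul, Completion.extension_coe hu, Completion.extension_coe hu,
          map_smul] }

variable (hP : ∀ a b : Part ι, a.degree < b.degree → a < b) {n : ℤ}

lemma continuous_completedCoord (π : PartitionsOf ι n) : Continuous (completedCoord B hP π) :=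
  Completion.continuous_extension

lemma completedCoord_coe (π : PartitionsOf ι n) (a : D.Homog n) :
    completedCoord B hP π (a : Completion (D.Homog n)) = (homogBasis B n).coord π a :=
  Completion.extension_coe (uniformContinuous_coord B hP π) a

lemma completedCoord_self (π : PartitionsOf ι n) :
    completedCoord B hP π (completedMonomial B π) = 1 := by
  rw [completedMonomial, completedCoord_coe, ← homogBasis_apply]
  simp

lemma completedCoord_of_ne {π κ : PartitionsOf ι n} (h : κ ≠ π) :
    completedCoord B hP π (completedMonomial B κ) = 0 := by
  rw [completedMonomial, completedCoord_coe, ← homogBasis_apply]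
  simp [Finsupp.single_eq_of_ne' h]

variable (D n) in
/-- The canonical map of `𝒰^σ(n/T)` into its completion, as a linear map. -/
def toCompleted : D.Homog n →ₗ[ℂ] D.Completed n where
  toFun a := (a : Completion (D.Homog n))
  map_add' := Completion.coe_add
  map_smul' := Completion.coe_smul

variable (D n) in
/-- The closure of `V_p(n/T)` in the completion. -/
def completedNbhd (p : ℕ) : Submodule ℂ (D.Completed n) :=
  ((D.nbhdIn p n).map (toCompleted D n)).topologicalClosure

lemma toCompleted_mem_completedNbhd {p : ℕ} {a : D.Homog n} (ha : a ∈ D.nbhdIn p n) :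
    toCompleted D n a ∈ completedNbhd D n p :=
  Submodule.le_topologicalClosure _ (Submodule.mem_map_of_mem ha)

lemma completedNbhd_mem_nhds {p : ℕ} (hp : 1 ≤ p) :
    (completedNbhd D n p : Set (D.Completed n)) ∈ 𝓝 0 := by
  have h := (Completion.isDenseInducing_coe (α := D.Homog n)).closure_image_mem_nhds
    ((hasBasis_nhds_zero n).mem_of_mem hp)
  rw [Completion.coe_zero] at h
  exact h

/-- By regularity `s` may be shrunk to a closed neighbourhood; a V_p inside its preimage then has
its closure inside it too. -/
lemma exists_completedNbhd_subset {s : Set (D.Completed n)} (hs : s ∈ 𝓝 0) :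
    ∃ p : ℕ, 1 ≤ p ∧ (completedNbhd D n p : Set (D.Completed n)) ⊆ s := by
  obtain ⟨t, ht, htc, hts⟩ := exists_mem_nhds_isClosed_subset hs
  have ht' : ((↑) : D.Homog n → D.Completed n) ⁻¹' t ∈ 𝓝 0 :=
    (Completion.continuous_coe (D.Homog n)).continuousAt.preimage_mem_nhds
      (by rwa [Completion.coe_zero])
  obtain ⟨p, hp, hpt⟩ := (hasBasis_nhds_zero n).mem_iff.1 ht'
  refine ⟨p, hp, (closure_minimal ?_ htc).trans hts⟩
  rintro _ ⟨a, ha, rfl⟩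
  exact hpt ha

lemma completedCoord_eq_zero_of_mem_completedNbhd {p : ℕ} {π : PartitionsOf ι n}
    (hπ : π.1.positivePart.degree < p * T) {x : D.Completed n} (hx : x ∈ completedNbhd D n p) :
    completedCoord B hP π x = 0 := by
  have hclosed : IsClosed {x | completedCoord B hP π x = 0} :=
    isClosed_singleton.preimage (continuous_completedCoord B hP π)
  refine closure_minimal ?_ hclosed hx
  rintro _ ⟨a, ha, rfl⟩
  exact (completedCoord_coe B hP π a).trans (coord_eq_zero_of_mem_nbhdIn B hP hπ ha)

/-- The closure of the span of the `u(π)` with `Q π`. -/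
def closedSpan (Q : PartitionsOf ι n → Prop) : Submodule ℂ (D.Completed n) :=
  (Submodule.span ℂ {x | ∃ π : PartitionsOf ι n, Q π ∧
    x = completedMonomial B π}).topologicalClosure

open Classical in
/-- The closed span of a set of monomials is cut out by the vanishing of the other coefficients. -/
theorem mem_closedSpan_iff (Q : PartitionsOf ι n → Prop) (x : D.Completed n) :
    x ∈ closedSpan B Q ↔ ∀ π, ¬ Q π → completedCoord B hP π x = 0 := by
  constructor
  · intro hx π hπ
    have hclosed : IsClosed {x | completedCoord B hP π x = 0} :=
      isClosed_singleton.preimage (continuous_completedCoord B hP π)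
    refine closure_minimal ?_ hclosed hx
    suffices Submodule.span ℂ {x | ∃ π : PartitionsOf ι n, Q π ∧ x = completedMonomial B π} ≤
      LinearMap.ker (completedCoord B hP π) from this
    rw [Submodule.span_le]
    rintro _ ⟨κ, hκ, rfl⟩
    exact completedCoord_of_ne B hP fun h => hπ (h ▸ hκ)
  · intro hx
    refine mem_closure_iff_nhds.2 fun s hs => ?_
    have hs' : (fun y => x - y) ⁻¹' s ∈ 𝓝 (0 : D.Completed n) :=
      (continuous_const.sub continuous_id).continuousAt.preimage_mem_nhds
        (by simpa using hs)
    obtain ⟨p, hp, hps⟩ := exists_completedNbhd_subset hs'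
    obtain ⟨a, ha⟩ : ∃ a : D.Homog n, x - toCompleted D n a ∈ completedNbhd D n p := by
      have hmem : (fun y => x - y) ⁻¹' (completedNbhd D n p : Set (D.Completed n)) ∈ 𝓝 x :=
        (continuous_const.sub continuous_id).continuousAt.preimage_mem_nhds
          (by simpa using completedNbhd_mem_nhds hp)
      obtain ⟨_, hy, a, rfl⟩ := mem_closure_iff_nhds.1 (Completion.denseRange_coe x) _ hmem
      exact ⟨a, hy⟩
    -- Coefficients of positive degree below pT vanish on the closure of V_p, so those of the
    -- approximant `a` are exactly those of `x`.
    have hcoord : ∀ π : PartitionsOf ι n, π.1.positivePart.degree < p * T →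
        completedCoord B hP π x = (homogBasis B n).repr a π := fun π hπ => by
      have h := completedCoord_eq_zero_of_mem_completedNbhd B hP hπ ha
      rw [map_sub, sub_eq_zero] at h
      exact h.trans (completedCoord_coe B hP π a)
    set r := (homogBasis B n).repr a with hr
    have hsum : a = ∑ π ∈ r.support, r π • homogMonomial B π := by
      conv_lhs => rw [← (homogBasis B n).linearCombination_repr a]
      rw [Finsupp.linearCombination_apply, Finsupp.sum]
      simp only [homogBasis_apply, hr]
    -- The remaining terms of `a` lie in V_p, so dropping them keeps the approximation. Every
    -- monomial kept has a nonzero coefficient in `x`, hence satisfies `Q`.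
    set low := r.support.filter fun π => π.1.positivePart.degree < (p : ℤ) * T with hlow
    set a' := ∑ π ∈ low, r π • homogMonomial B π with ha'
    have hdiff : a - a' ∈ D.nbhdIn p n := by
      have e : a - a' = ∑ π ∈ r.support.filter (fun π => ¬ π.1.positivePart.degree < (p : ℤ) * T),
          r π • homogMonomial B π := by
        rw [sub_eq_iff_eq_add', ha', hlow, Finset.sum_filter_add_sum_filter_not, ← hsum]
      rw [e]
      refine Submodule.sum_mem _ fun π hπ => Submodule.smul_mem _ _
        (homogMonomial_mem_nbhdIn B hP (not_lt.1 (Finset.mem_filter.1 hπ).2))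
    refine ⟨toCompleted D n a', ?_, ?_⟩
    · have h : x - toCompleted D n a' ∈ completedNbhd D n p := by
        have := add_mem ha (toCompleted_mem_completedNbhd hdiff)
        rwa [map_sub, sub_add_sub_cancel] at this
      have h' := hps h
      rwa [Set.mem_preimage, sub_sub_cancel] at h'
    · rw [ha', map_sum]
      refine Submodule.sum_mem _ fun π hπ => ?_
      rw [map_smul]
      obtain ⟨hsupp, hlt⟩ := Finset.mem_filter.1 hπ
      refine Submodule.smul_mem _ _ (Submodule.subset_span ⟨π, ?_, rfl⟩)
      by_contra hQ
      exact Finsupp.mem_support_iff.1 hsupp ((hcoord π hlt).symm.trans (hx π hQ))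

/-- An element of the completion is determined by its coefficients. -/
lemma eq_zero_of_completedCoord_eq_zero {x : D.Completed n}
    (h : ∀ π, completedCoord B hP π x = 0) : x = 0 := by
  have hx : x ∈ closedSpan B fun _ : PartitionsOf ι n => False :=
    (mem_closedSpan_iff B hP _ x).2 fun π _ => h π
  have hset : {x : D.Completed n | ∃ π : PartitionsOf ι n, False ∧ x = completedMonomial B π} =
      ∅ := by ext; simp
  -- For the empty family the closed span is the closure of 0, which is 0 since the completion is
  -- Hausdorff.
  rw [closedSpan, hset, Submodule.span_empty] at hx
  have hx' : x ∈ closure ({0} : Set (D.Completed n)) := hx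
  rwa [closure_singleton] at hx'

end Coordinates

/-! ### Leading terms as least elements of the support. -/

section LeadingTerms

variable {𝔤 : Type u} [LieRing 𝔤] [LieAlgebra ℂ 𝔤] {T : ℕ} [NeZero T] {D : Datum 𝔤 T}
  {ι : ZMod T → Type v} (B : ∀ j, Module.Basis (ι j) ℂ (D.component j)) [LinearOrder (Part ι)]
  [LinearOrder (ColoredPartition ι)] (hP : ∀ a b : Part ι, a.degree < b.degree → a < b) {n : ℤ}

lemma mem_closedGE_iff (π : PartitionsOf ι n) (x : D.Completed n) :
    x ∈ closedGE B π ↔ ∀ κ < π, completedCoord B hP κ x = 0 := by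
  refine (mem_closedSpan_iff B hP (fun κ => π ≤ κ) x).trans (forall_congr' fun κ => ?_)
  rw [not_le]

lemma mem_closedGT_iff (π : PartitionsOf ι n) (x : D.Completed n) :
    x ∈ closedGT B π ↔ ∀ κ ≤ π, completedCoord B hP κ x = 0 := by
  refine (mem_closedSpan_iff B hP (fun κ => π < κ) x).trans (forall_congr' fun κ => ?_)
  rw [not_lt]

/-- The coefficients below π vanish already, so a single condition remains. Both claims of (a) rest
on this. -/
lemma mem_closedGT_iff_of_mem_closedGE {π : PartitionsOf ι n} {x : D.Completed n}
    (hx : x ∈ closedGE B π) : x ∈ closedGT B π ↔ completedCoord B hP π x = 0 := by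
  rw [mem_closedGT_iff B hP]
  refine ⟨fun h => h π le_rfl, fun h κ hκ => ?_⟩
  rcases hκ.eq_or_lt with rfl | hκ
  · exact h
  · exact (mem_closedGE_iff B hP π x).1 hx κ hκ

lemma completedMonomial_mem_closedGE (π : PartitionsOf ι n) :
    completedMonomial B π ∈ closedGE B π :=
  Submodule.le_topologicalClosure _ (Submodule.subset_span ⟨π, le_rfl, rfl⟩)

include hP in
lemma closedGT_le_closedGE (π : PartitionsOf ι n) : closedGT B π ≤ closedGE B π := fun x hx =>
  (mem_closedGE_iff B hP π x).2 fun κ hκ => (mem_closedGT_iff B hP π x).1 hx κ hκ.le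

include hP in
theorem closedGE_eq_sup (π : PartitionsOf ι n) :
    closedGE B π = Submodule.span ℂ {completedMonomial B π} ⊔ closedGT B π := by
  refine le_antisymm (fun x hx => ?_) (sup_le ?_ (closedGT_le_closedGE B hP π))
  · rw [← add_sub_cancel (completedCoord B hP π x • completedMonomial B π) x]
    refine Submodule.add_mem_sup (Submodule.smul_mem _ _ (Submodule.mem_span_singleton_self _)) ?_
    rw [mem_closedGT_iff_of_mem_closedGE B hP
      (sub_mem hx (Submodule.smul_mem _ _ (completedMonomial_mem_closedGE B π)))]
    rw [map_sub, map_smul, completedCoord_self, smul_eq_mul, mul_one, sub_self]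
  · rw [Submodule.span_singleton_le_iff_mem]
    exact completedMonomial_mem_closedGE B π

include hP in
theorem finrank_closedGE_quotient (π : PartitionsOf ι n) :
    Module.finrank ℂ (closedGE B π ⧸ (closedGT B π).submoduleOf (closedGE B π)) = 1 := by
  set f : closedGE B π →ₗ[ℂ] ℂ := (completedCoord B hP π).domRestrict (closedGE B π) with hf
  have hker : (closedGT B π).submoduleOf (closedGE B π) = LinearMap.ker f := by
    ext x
    rw [Submodule.submoduleOf, Submodule.mem_comap, LinearMap.mem_ker]
    exact mem_closedGT_iff_of_mem_closedGE B hP x.2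
  have hsurj : Function.Surjective f := fun r =>
    ⟨r • ⟨completedMonomial B π, completedMonomial_mem_closedGE B π⟩, by
      rw [map_smul, hf, LinearMap.domRestrict_apply, completedCoord_self, smul_eq_mul, mul_one]⟩
  rw [hker, (f.quotKerEquivOfSurjective hsurj).finrank_eq, Module.finrank_self]

/-- Identifies a leading term with the least element of the support of the coefficients. -/
lemma isLeadingTerm_iff (x : D.Completed n) (π : PartitionsOf ι n) :
    IsLeadingTerm B x π ↔ (∀ κ < π, completedCoord B hP κ x = 0) ∧
      completedCoord B hP π x ≠ 0 := by
  rw [IsLeadingTerm, ← mem_closedGE_iff B hP]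
  exact and_congr_right fun hx => (mem_closedGT_iff_of_mem_closedGE B hP hx).not

theorem existsUnique_isLeadingTerm (h : IsAdmissible ι) {x : D.Completed n}
    (hx : x ∈ homogUP B n) (hx0 : x ≠ 0) : ∃! π : PartitionsOf ι n, IsLeadingTerm B x π := by
  obtain ⟨π₀, hπ₀⟩ := Set.mem_iUnion.1 hx
  have hπ₀ := (mem_closedGE_iff B h.part_lt π₀ x).1 hπ₀
  set S : Set (ColoredPartition ι) :=
    {π | ∃ hπ : π.degree = n, completedCoord B h.part_lt ⟨π, hπ⟩ x ≠ 0} with hS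
  have hne : S.Nonempty := by
    by_contra hcon
    refine hx0 (eq_zero_of_completedCoord_eq_zero B h.part_lt fun π => ?_)
    by_contra hπ
    exact hcon ⟨π.1, π.2, hπ⟩
  -- A partition longer than π₀ precedes it, so its coefficient vanishes. The support thus has
  -- bounded length and condition 4 applies.
  obtain ⟨π, ⟨hπn, hπ⟩, hmin⟩ := h.exists_min π₀.1.length n S hne (by
    rintro κ ⟨hκn, hκ⟩
    refine ⟨?_, hκn⟩
    by_contra hlen
    exact hκ (hπ₀ ⟨κ, hκn⟩ (h.lt_of_length _ _ (not_le.1 hlen))))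
  refine ⟨⟨π, hπn⟩, (isLeadingTerm_iff B h.part_lt x _).2 ⟨fun κ hκ => ?_, hπ⟩, fun κ hκ => ?_⟩
  · by_contra hne
    exact (hmin κ.1 ⟨κ.2, hne⟩).not_gt hκ
  · obtain ⟨hκ₁, hκ₂⟩ := (isLeadingTerm_iff B h.part_lt x κ).1 hκ
    refine le_antisymm ?_ (hmin κ.1 ⟨κ.2, hκ₂⟩)
    by_contra hlt
    exact hπ (hκ₁ ⟨π, hπn⟩ (not_le.1 hlt))

end LeadingTerms

end TwistedAffine

end

theorem proposition2p3 {𝔤 : Type*} [LieRing 𝔤] [LieAlgebra ℂ 𝔤] [FiniteDimensional ℂ 𝔤]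
    [LieAlgebra.IsSimple ℂ 𝔤] {T : ℕ} [NeZero T] (D : TwistedAffine.Datum 𝔤 T)
    {ι : ZMod T → Type*} (B : ∀ j, Module.Basis (ι j) ℂ (D.component j))
    [LinearOrder (TwistedAffine.Part ι)] [LinearOrder (TwistedAffine.ColoredPartition ι)]
    (hP : TwistedAffine.IsAdmissible ι) :
    (∀ (n : ℤ) (π : TwistedAffine.PartitionsOf ι n),
      TwistedAffine.closedGE B π =
        Submodule.span ℂ {TwistedAffine.completedMonomial B π} ⊔ TwistedAffine.closedGT B π ∧
      Module.finrank ℂ (TwistedAffine.closedGE B π ⧸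
        (TwistedAffine.closedGT B π).submoduleOf (TwistedAffine.closedGE B π)) = 1) ∧
    (∀ (n : ℤ) (x : D.Completed n), x ∈ TwistedAffine.homogUP B n → x ≠ 0 →
      ∃! π : TwistedAffine.PartitionsOf ι n, TwistedAffine.IsLeadingTerm B x π) :=
  ⟨fun _ π => ⟨TwistedAffine.closedGE_eq_sup B hP.part_lt π,
    TwistedAffine.finrank_closedGE_quotient B hP.part_lt π⟩,
    fun _ _ hx hx0 => TwistedAffine.existsUnique_isLeadingTerm B hP hx hx0⟩
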